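/- Let $K$ be a field and $K\langle X\rangle=K\langle X_1,\ldots,X_N\rangle$ the free associative algebra, with $K$-basis the set $\mathcal B$ of monomials (words, including $1$) in the $X_i$. Give $X_i$ a positive integer degree $m_i$, and $K\langle X\rangle$ the corresponding weighted $\mathbb N$-gradation; $d_{\rm gr}(f)$ denotes the degree of a nonzero homogeneous element $f$. Let $\prec$ be a monomial ordering on $\mathcal B$, i.e. a well-ordering such that $u\prec v$ implies $wus\prec wvs$, and $v=wus\neq u$ implies $u\prec v$. For $f\ne0$ let $\mathbf{LM}(f)$ and $\mathbf{LC}(f)$ be its leading monomial and leading coefficient. A monomial $u$ divides $v$, written $u\mid v$, if $v=wus$ for some monomials $w,s$. Ideals are two-sided. *Division.* A remainder $\overline f^{\,\mathcal G}$ of $f$ on division by a finite set $\mathcal G$ of nonzero elements is a result $r$ of the division algorithm: start with $p:=f$, $r:=0$; while $p\ne0$, if $\mathbf{LM}(p)=a\,\mathbf{LM}(g)\,b$ for some $g\in\mathcal G$ and monomials $a,b$, choose such $g,a,b$ and replace $p$ by $p-\frac{\mathbf{LC}(p)}{\mathbf{LC}(g)}\,a g b$; otherwise move the leading term of $p$ from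 $p$ to $r$. *Overlap elements.* An overlap element $o(f,g)$ of nonzero $f,g$ is any element $\frac1{\mathbf{LC}(f)}fu-\frac1{\mathbf{LC}(g)}vg$ with $u,v\in\mathcal B$ such that $\mathbf{LM}(f)u=v\mathbf{LM}(g)$, $\mathbf{LM}(f)\nmid v$ and $\mathbf{LM}(g)\nmid u$. *Truncated Gröbner bases.* A set $H$ is an $n$-truncated Gröbner basis of an ideal $I$ if $H=\{g\in G: d_{\rm gr}(g)\le n\}$ for some finite set $G$ of nonzero homogeneous elements generating $I$, and for every nonzero homogeneous $f\in I$ with $d_{\rm gr}(f)\le n$ there is $g\in H$ with $\mathbf{LM}(g)\mid\mathbf{LM}(f)$. *The algorithm.* Input: nonzero homogeneous elements $f_1,\ldots,f_m$ ($m\ge1$), $F=\{f_1,\ldots,f_m\}$, with $d_{\rm gr}(f_1)\le\cdots\le d_{\rm gr}(f_m)$, and a positive integer $n_0\ge d_{\rm gr}(f_1)$. Initialize $\mathcal O:=\emptyset$, $W:=F$, $\mathcal G:=\emptyset$, $t':=0$. Repeat the following. 1. Let $n$ be the least degree of an element of $W\cup\mathcal O$. Let $\mathcal O_n$ and $W_n$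 be the sets of elements of degree $n$ of $\mathcal O$ and $W$, and remove them from $\mathcal O$ and $W$, respectively. 2. While $\mathcal O_n\ne\emptyset$: remove any element $h$ from $\mathcal O_n$ and compute a remainder $r=\overline h^{\,\mathcal G}$. If $r\neq0$, then put $t':=t'+1$, $g_{t'}:=r$, add to $\mathcal O$ all nonzero overlap elements $o(g_i,g_{t'})$, $o(g_{t'},g_i)$ $(i<t')$ and $o(g_{t'},g_{t'})$ of degree $\le n_0$, and add $g_{t'}$ to $\mathcal G$. 3. While $W_n\ne\emptyset$: remove any element $h$ from $W_n$ and treat it exactly as $h$ in step 2. Stop as soon as, after step 3, $\mathcal O=\emptyset$ and $W$ contains no element of degree $\le n_0$. **Proposition 2.5.** For every such input, and whatever choices are made, the algorithm (including all divisions) can always be carried on until it stops, and it stops after finitely many steps. The resulting $\mathcal G=\{g_1,\ldots,g_t\}$ is an $n_0$-truncated Gröbner basis of the ideal $I=\langle F\rangle$, and $d_{\rm gr}(g_1)\le d_{\rm gr}(g_2)\le\cdots\le d_{\rm gr}(g_t)$. -/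

import Mathlib

namespace FreeGB

/-- The monomials `1, X_{i₁} ⋯ X_{iₛ}` in the noncommuting variables `X_1, …, X_N`. -/
abbrev Mon (N : ℕ) : Type := FreeMonoid (Fin N)

/-- The free algebra `K⟨X_1, …, X_N⟩`, presented on its standard basis of monomials
(isomorphic to Mathlib's `FreeAlgebra K (Fin N)` through
`FreeAlgebra.equivMonoidAlgebraFreeMonoid`). -/
abbrev FreeAlg (K : Type*) [Field K] (N : ℕ) : Type _ := MonoidAlgebra K (Mon N)

/-- The weighted degree of a monomial, the variable `X_i` having degree `wt i`. -/
def monDeg {N : ℕ} (wt : Fin N → ℕ) (w : Mon N) : ℕ := (w.toList.map wt).sum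

/-- `f` is a nonzero homogeneous element of degree `q`. -/
def HasDegree {K : Type*} [Field K] {N : ℕ} (wt : Fin N → ℕ) (f : FreeAlg K N) (q : ℕ) : Prop :=
  f ≠ 0 ∧ ∀ w ∈ f.coeff.support, monDeg wt w = q

/-- `u` divides `v`: `v = w u s` for some monomials `w`, `s`. -/
def Divides {N : ℕ} (u v : Mon N) : Prop := ∃ w s : Mon N, v = w * u * s

/-- `lt` is (the strict relation of) a monomial ordering. -/
structure IsMonomialOrder {N : ℕ} (lt : Mon N → Mon N → Prop) : Prop where
  wellOrder : IsWellOrder (Mon N) lt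
  mul_mul : ∀ w u v s : Mon N, lt u v → lt (w * u * s) (w * v * s)
  lt_of_divides : ∀ u v w s : Mon N, v ≠ u → v = w * u * s → lt u v

/-- `w` is the largest monomial occurring in `f`. -/
def IsLeadingMonomial {K : Type*} [Field K] {N : ℕ} (lt : Mon N → Mon N → Prop)
    (f : FreeAlg K N) (w : Mon N) : Prop :=
  w ∈ f.coeff.support ∧ ∀ v ∈ f.coeff.support, v ≠ w → lt v w

open Classical in
/-- The leading monomial of a nonzero element (the value at `0` is irrelevant). -/
noncomputable def LM {K : Type*} [Field K] {N : ℕ} (lt : Mon N → Mon N → Prop)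
    (f : FreeAlg K N) : Mon N :=
  if h : ∃ w, IsLeadingMonomial lt f w then h.choose else 1

/-- The leading coefficient of a nonzero element. -/
noncomputable def LC {K : Type*} [Field K] {N : ℕ} (lt : Mon N → Mon N → Prop)
    (f : FreeAlg K N) : K := f.coeff (LM lt f)

/-- A monomial as an element of the free algebra. -/
noncomputable def mon (K : Type*) [Field K] {N : ℕ} (w : Mon N) : FreeAlg K N :=
  MonoidAlgebra.single w 1

/-- `h` is an overlap element `o(f, u; v, g)` of the nonzero elements `f` and `g`. -/
def IsOverlap {K : Type*} [Field K] {N : ℕ} (lt : Mon N → Mon N → Prop)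
    (f g h : FreeAlg K N) : Prop :=
  f ≠ 0 ∧ g ≠ 0 ∧ ∃ u v : Mon N, LM lt f * u = v * LM lt g ∧
    ¬ Divides (LM lt f) v ∧ ¬ Divides (LM lt g) u ∧
    h = (LC lt f)⁻¹ • (f * mon K u) - (LC lt g)⁻¹ • (mon K v * g)

/-- The two-sided ideal generated by a set. -/
noncomputable abbrev ideal {K : Type*} [Field K] {N : ℕ} (S : Set (FreeAlg K N)) :
    TwoSidedIdeal (FreeAlg K N) := TwoSidedIdeal.span S

/-- `H` is an `n`-truncated Gröbner basis of the two-sided ideal `I`: `H = G_{≤ n}` for some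
finite set `G` of homogeneous generators of `I`, and for every nonzero homogeneous `f ∈ I` of
degree at most `n` some element of `H` has a leading monomial dividing that of `f`. -/
def IsTruncatedGB {K : Type*} [Field K] {N : ℕ} (wt : Fin N → ℕ) (lt : Mon N → Mon N → Prop)
    (n : ℕ) (I : TwoSidedIdeal (FreeAlg K N)) (H : Set (FreeAlg K N)) : Prop :=
  ∃ G : Set (FreeAlg K N), G.Finite ∧ (∀ g ∈ G, ∃ q, HasDegree wt g q) ∧ I = ideal G ∧
    H = {g | g ∈ G ∧ ∃ q ≤ n, HasDegree wt g q} ∧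
    ∀ f ∈ I, (∃ q ≤ n, HasDegree wt f q) → ∃ g ∈ H, Divides (LM lt g) (LM lt f)

/-- One step of the division algorithm by the elements of the list `G`. In a pair `(p, r)`, the
polynomial `p` is what is still to be divided and `r` is the remainder collected so far. If the
leading monomial of `p` is divisible by that of some `g ∈ G`, it is cancelled with a multiple of
such a `g` (any choice is allowed); otherwise the leading term of `p` is moved to `r`. A
remainder of `f` on division by `G` is an `r` for which `(0, r)` is reached from `(f, 0)`. -/
inductive DivStep {K : Type*} [Field K] {N : ℕ} (lt : Mon N → Mon N → Prop)
    (G : List (FreeAlg K N)) : FreeAlg K N × FreeAlg K N → FreeAlg K N × FreeAlg K N → Prop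
  | cancel (p r g : FreeAlg K N) (a b : Mon N) (hp : p ≠ 0) (hg : g ∈ G)
      (h : LM lt p = a * LM lt g * b) :
      DivStep lt G (p, r) (p - (LC lt p / LC lt g) • (mon K a * g * mon K b), r)
  | move (p r : FreeAlg K N) (hp : p ≠ 0) (h : ∀ g ∈ G, ¬ Divides (LM lt g) (LM lt p)) :
      DivStep lt G (p, r)
        (p - MonoidAlgebra.single (LM lt p) (LC lt p),
          r + MonoidAlgebra.single (LM lt p) (LC lt p))

/-- Where the algorithm currently is. -/
inductive Ctrl (K : Type*) [Field K] (N : ℕ) where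
  /-- at the head of LOOP -/
  | loop
  /-- at the test of the first WHILE loop -/
  | overlaps
  /-- in the first WHILE loop, dividing: `p` is left, `r` is the remainder so far -/
  | divOverlap (p r : FreeAlg K N)
  /-- at the test of the second WHILE loop -/
  | gens
  /-- in the second WHILE loop, dividing: `p` is left, `r` is the remainder so far -/
  | divGen (p r : FreeAlg K N)
  /-- the algorithm has ended -/
  | halted

/-- A state of the algorithm: the control point and the values of the variables
`𝒪_{≤ n₀}`, `𝒪_n`, `W`, `W_n` and `𝒢 = {g_1, …, g_{t'}}`, the last one kept as a list in the order
in which its elements were found. -/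
structure State (K : Type*) [Field K] (N : ℕ) where
  ctrl : Ctrl K N
  O : Set (FreeAlg K N)
  On : Set (FreeAlg K N)
  W : Set (FreeAlg K N)
  Wn : Set (FreeAlg K N)
  G : List (FreeAlg K N)

/-- The initial state on the input `F`. -/
def init {K : Type*} [Field K] {N : ℕ} (F : Set (FreeAlg K N)) : State K N where
  ctrl := .loop
  O := ∅
  On := ∅
  W := F
  Wn := ∅
  G := []

/-- The overlap elements of degree at most `n₀` of `r` with the elements of `G`, on either side,
and of `r` with itself (the zero element has no degree and is left out). -/
def newOverlaps {K : Type*} [Field K] {N : ℕ} (wt : Fin N → ℕ) (lt : Mon N → Mon N → Prop)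
    (n₀ : ℕ) (G : List (FreeAlg K N)) (r : FreeAlg K N) : Set (FreeAlg K N) :=
  {h | ((∃ g ∈ G, IsOverlap lt g r h ∨ IsOverlap lt r g h) ∨ IsOverlap lt r r h) ∧
    ∃ q ≤ n₀, HasDegree wt h q}

open Classical in
/-- The IF block: a nonzero remainder `r` is appended to `𝒢` and its overlaps to `𝒪_{≤ n₀}`. -/
noncomputable def record {K : Type*} [Field K] {N : ℕ} (wt : Fin N → ℕ)
    (lt : Mon N → Mon N → Prop) (n₀ : ℕ) (s : State K N) (r : FreeAlg K N) : State K N :=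
  if r = 0 then s
  else { s with O := s.O ∪ newOverlaps wt lt n₀ s.G r, G := s.G ++ [r] }

/-- The UNTIL condition: `𝒪_{≤ n₀}` is empty and `W` has no element of degree at most `n₀`. -/
def Finished {K : Type*} [Field K] {N : ℕ} (wt : Fin N → ℕ) (n₀ : ℕ) (s : State K N) : Prop :=
  s.O = ∅ ∧ ¬ ∃ f ∈ s.W, ∃ q ≤ n₀, HasDegree wt f q

/-- One step of the algorithm. Every choice the algorithm leaves open is nondeterministic here. -/
inductive Step {K : Type*} [Field K] {N : ℕ} (wt : Fin N → ℕ) (lt : Mon N → Mon N → Prop)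
    (n₀ : ℕ) : State K N → State K N → Prop
  /-- LOOP: take the smallest degree `n` in `W ∪ 𝒪_{≤ n₀}`, split off `𝒪_n` and `W_n`. -/
  | enter (s : State K N) (n : ℕ) (hc : s.ctrl = .loop)
      (hn : IsLeast {q | ∃ x ∈ s.W ∪ s.O, HasDegree wt x q} n) :
      Step wt lt n₀ s
        { s with
          ctrl := .overlaps
          On := {h | h ∈ s.O ∧ HasDegree wt h n}
          Wn := {f | f ∈ s.W ∧ HasDegree wt f n}
          O := s.O \ {h | h ∈ s.O ∧ HasDegree wt h n}
          W := s.W \ {f | f ∈ s.W ∧ HasDegree wt f n} }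
  /-- First WHILE loop: choose an overlap element and start dividing it by `𝒢`. -/
  | chooseOverlap (s : State K N) (h : FreeAlg K N) (hc : s.ctrl = .overlaps) (hh : h ∈ s.On) :
      Step wt lt n₀ s { s with ctrl := .divOverlap h 0, On := s.On \ {h} }
  | divideOverlap (s : State K N) (p r p' r' : FreeAlg K N) (hc : s.ctrl = .divOverlap p r)
      (hd : DivStep lt s.G (p, r) (p', r')) :
      Step wt lt n₀ s { s with ctrl := .divOverlap p' r' }
  | recordOverlap (s : State K N) (r : FreeAlg K N) (hc : s.ctrl = .divOverlap 0 r) :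
      Step wt lt n₀ s { record wt lt n₀ s r with ctrl := .overlaps }
  | endOverlaps (s : State K N) (hc : s.ctrl = .overlaps) (hO : s.On = ∅) :
      Step wt lt n₀ s { s with ctrl := .gens }
  /-- Second WHILE loop: choose an input element and start dividing it by `𝒢`. -/
  | chooseGen (s : State K N) (f : FreeAlg K N) (hc : s.ctrl = .gens) (hf : f ∈ s.Wn) :
      Step wt lt n₀ s { s with ctrl := .divGen f 0, Wn := s.Wn \ {f} }
  | divideGen (s : State K N) (p r p' r' : FreeAlg K N) (hc : s.ctrl = .divGen p r)
      (hd : DivStep lt s.G (p, r) (p', r')) :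
      Step wt lt n₀ s { s with ctrl := .divGen p' r' }
  | recordGen (s : State K N) (r : FreeAlg K N) (hc : s.ctrl = .divGen 0 r) :
      Step wt lt n₀ s { record wt lt n₀ s r with ctrl := .gens }
  /-- UNTIL: go back to the head of LOOP, or end. -/
  | again (s : State K N) (hc : s.ctrl = .gens) (hW : s.Wn = ∅) (hu : ¬ Finished wt n₀ s) :
      Step wt lt n₀ s { s with ctrl := .loop }
  | halt (s : State K N) (hc : s.ctrl = .gens) (hW : s.Wn = ∅) (hu : Finished wt n₀ s) :
      Step wt lt n₀ s { s with ctrl := .halted }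

/-- `s` is reached by a partial run of the algorithm on the input `F`, `n₀`. -/
def Reachable {K : Type*} [Field K] {N : ℕ} (wt : Fin N → ℕ) (lt : Mon N → Mon N → Prop)
    (n₀ : ℕ) (F : Set (FreeAlg K N)) (s : State K N) : Prop :=
  Relation.ReflTransGen (Step wt lt n₀) (init F) s

end FreeGB

/-! Correctness is the diamond lemma (Buchberger's criterion for words), cut off at degree `n₀`.
Take homogeneous elements whose leading monomials do not divide one another, such that every overlap
element of degree at most `n₀` is a combination of multiples `a g b` with leading words below the
overlap word. Two normalised multiples with the same leading word of degree at most `n₀` then differ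
by multiples with lower leading words: two occurrences in a word are disjoint, overlap, or are
nested, and proper nesting is excluded (`Confluent.sub_mem`). So a combination of multiples can be
rewritten until a single one has the greatest leading word; that word is the leading monomial of the
sum (`Confluent.divides_LM`). Homogeneity keeps the rewriting inside one degree, so nothing above
`n₀` is needed.

That the algorithm produces such a set and stops rests on a degree estimate: a remainder is reduced
modulo the earlier elements, so its nonzero overlap elements have strictly larger degree than itself
(`lt_degree_of_mem_newOverlaps`). A round of degree `n` therefore never refills its own work lists,
and the rounds have strictly increasing degrees, at most `n₀`. Since remainders appear in
nondecreasing degree, a later leading monomial cannot divide an earlier one either, and no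
interreduction is needed.

Division writes the overlap element as its remainder plus lower multiples, and the remainder becomes
a multiple too once it joins `𝒢`. `Invariant` keeps track of this; `Invariant.step` shows that each
step preserves it and decreases a well-founded measure. Input elements left in `W` at the end have
degree above `n₀`; they only complete the generating set. -/

namespace FreeGB

variable {K : Type*} [Field K] {N : ℕ} {wt : Fin N → ℕ} {lt : Mon N → Mon N → Prop}

/-! ### Monomials -/

theorem monDeg_mul (u v : Mon N) : monDeg wt (u * v) = monDeg wt u + monDeg wt v := by
  simp [monDeg, FreeMonoid.toList_mul]

theorem monDeg_pos (hwt : ∀ i, 0 < wt i) {u : Mon N} (hu : u ≠ 1) : 0 < monDeg wt u := by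
  induction u using FreeMonoid.casesOn with
  | one => exact absurd rfl hu
  | of_mul x xs => simp [monDeg, FreeMonoid.toList_mul, hwt x]

theorem divides_refl (u : Mon N) : Divides u u := ⟨1, 1, by simp⟩

theorem Divides.length_le {u v : Mon N} (h : Divides u v) : u.length ≤ v.length := by
  obtain ⟨a, b, rfl⟩ := h
  simp only [FreeMonoid.length_mul]
  omega

/-- Levi's lemma for words. It decides the relative position of two factors of the same word. -/
theorem mul_eq_mul_cases {a b c d : Mon N} (h : a * b = c * d) :
    (∃ e, c = a * e ∧ b = e * d) ∨ ∃ e, a = c * e ∧ d = e * b :=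
  List.append_eq_append_iff.1 h

theorem eq_one_of_eq_mul_mul {a u v : Mon N} (h : a = u * a * v) : u = 1 ∧ v = 1 := by
  have := congrArg FreeMonoid.length h
  simp only [FreeMonoid.length_mul] at this
  exact ⟨FreeMonoid.length_eq_zero.1 (by omega), FreeMonoid.length_eq_zero.1 (by omega)⟩

/-! ### Monomial orderings -/

namespace IsMonomialOrder

variable (hlt : IsMonomialOrder lt)
include hlt

theorem trans {u v w : Mon N} (h₁ : lt u v) (h₂ : lt v w) : lt u w :=
  haveI := hlt.wellOrder
  _root_.trans_of lt h₁ h₂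

theorem irrefl (u : Mon N) : ¬ lt u u :=
  haveI := hlt.wellOrder
  _root_.irrefl_of lt u

theorem cases (u v : Mon N) : lt u v ∨ u = v ∨ lt v u :=
  haveI := hlt.wellOrder
  trichotomous_of lt u v

theorem wf : WellFounded lt := hlt.wellOrder.wf

theorem exists_greatest {s : Finset (Mon N)} (hs : s.Nonempty) :
    ∃ w ∈ s, ∀ v ∈ s, v ≠ w → lt v w := by
  induction hs using Finset.Nonempty.cons_induction with
  | singleton a => exact ⟨a, by simp, fun v hv hne => absurd (by simpa using hv) hne⟩
  | cons a s ha hs ih =>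
    obtain ⟨w, hw, hmax⟩ := ih
    rcases hlt.cases a w with h | rfl | h
    · refine ⟨w, by simp [hw], fun v hv hne => ?_⟩
      rcases Finset.mem_cons.1 hv with rfl | hv
      · exact h
      · exact hmax v hv hne
    · exact absurd hw ha
    · refine ⟨a, by simp, fun v hv hne => ?_⟩
      rcases Finset.mem_cons.1 hv with rfl | hv
      · exact absurd rfl hne
      · by_cases hvw : v = w
        · exact hvw ▸ h
        · exact hlt.trans (hmax v hv hvw) h

theorem isLeadingMonomial_LM {f : FreeAlg K N} (hf : f ≠ 0) :
    IsLeadingMonomial lt f (LM lt f) := by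
  have h : ∃ w, IsLeadingMonomial lt f w := hlt.exists_greatest <| by
    rwa [Finsupp.support_nonempty_iff, Ne, MonoidAlgebra.coeff_eq_zero]
  rw [LM, dif_pos h]
  exact h.choose_spec

theorem LM_eq {f : FreeAlg K N} {w : Mon N} (h : IsLeadingMonomial lt f w) : LM lt f = w := by
  have hf : f ≠ 0 := by
    rintro rfl
    simpa using h.1
  have h' := hlt.isLeadingMonomial_LM hf
  by_contra hne
  exact hlt.irrefl _ (hlt.trans (h.2 _ h'.1 hne) (h'.2 _ h.1 (Ne.symm hne)))

theorem LC_ne_zero {f : FreeAlg K N} (hf : f ≠ 0) : LC lt f ≠ 0 :=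
  Finsupp.mem_support_iff.1 (hlt.isLeadingMonomial_LM hf).1

theorem monDeg_LM {f : FreeAlg K N} {q : ℕ} (h : HasDegree wt f q) : monDeg wt (LM lt f) = q :=
  h.2 _ (hlt.isLeadingMonomial_LM h.1).1

end IsMonomialOrder

/-! ### Spans of monomials -/

theorem mon_mul (u v : Mon N) : mon K u * mon K v = mon K (u * v) := by
  simp [mon, MonoidAlgebra.single_mul_single]

theorem mon_one : mon K (1 : Mon N) = 1 := rfl

theorem single_eq_smul_mon (w : Mon N) (c : K) : MonoidAlgebra.single w c = c • mon K w := by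
  simp [mon]

/-- The elements all of whose monomials lie in `S`. -/
noncomputable def supportedOn (K : Type*) [Field K] {N : ℕ} (S : Set (Mon N)) :
    Submodule K (FreeAlg K N) :=
  Submodule.span K (mon K '' S)

theorem mon_mem_supportedOn {S : Set (Mon N)} {w : Mon N} (h : w ∈ S) :
    mon K w ∈ supportedOn K S :=
  Submodule.subset_span ⟨w, h, rfl⟩

theorem mem_supportedOn {S : Set (Mon N)} {x : FreeAlg K N} :
    x ∈ supportedOn K S ↔ ∀ m ∈ x.coeff.support, m ∈ S := by
  constructor
  · intro hx
    induction hx using Submodule.span_induction with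
    | mem x hx =>
      obtain ⟨w, hw, rfl⟩ := hx
      intro m hm
      have : m = w := by simpa [mon] using hm
      exact this ▸ hw
    | zero => simp
    | add x y _ _ hx hy =>
      intro m hm
      by_cases h : x.coeff m = 0
      · refine hy m (Finsupp.mem_support_iff.2 fun h' => ?_)
        simp [h, h'] at hm
      · exact hx m (Finsupp.mem_support_iff.2 h)
    | smul c x _ hx =>
      intro m hm
      refine hx m (Finsupp.mem_support_iff.2 fun h' => ?_)
      simp [h'] at hm
  · intro h
    rw [← MonoidAlgebra.sum_coeff_single x]
    refine Submodule.sum_mem _ fun m hm => ?_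
    rw [single_eq_smul_mon]
    exact Submodule.smul_mem _ _ (mon_mem_supportedOn (h m hm))

theorem supportedOn_mono {S T : Set (Mon N)} (h : S ⊆ T) : supportedOn K S ≤ supportedOn K T :=
  Submodule.span_mono (Set.image_mono h)

theorem coeff_eq_zero_of_mem_supportedOn {S : Set (Mon N)} {x : FreeAlg K N}
    (hx : x ∈ supportedOn K S) {w : Mon N} (hw : w ∉ S) : x.coeff w = 0 := by
  by_contra h
  exact hw (mem_supportedOn.1 hx w (Finsupp.mem_support_iff.2 h))

theorem mon_mul_mul_mon_mem_supportedOn {S T : Set (Mon N)} {x : FreeAlg K N} (a b : Mon N)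
    (hx : x ∈ supportedOn K S) (h : ∀ m ∈ S, a * m * b ∈ T) :
    mon K a * x * mon K b ∈ supportedOn K T := by
  induction hx using Submodule.span_induction with
  | mem x hx =>
    obtain ⟨w, hw, rfl⟩ := hx
    rw [mon_mul, mon_mul]
    exact mon_mem_supportedOn (h w hw)
  | zero => simp
  | add x y _ _ hx hy =>
    rw [mul_add, add_mul]
    exact add_mem hx hy
  | smul c x _ hx =>
    rw [mul_smul_comm, smul_mul_assoc]
    exact Submodule.smul_mem _ c hx

/-- The monomials smaller than `w` and of the same degree. -/
def lower (wt : Fin N → ℕ) (lt : Mon N → Mon N → Prop) (w : Mon N) : Set (Mon N) :=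
  {u | lt u w ∧ monDeg wt u = monDeg wt w}

theorem lower_mul_mem (hlt : IsMonomialOrder lt) (a b : Mon N) {u w : Mon N}
    (h : u ∈ lower wt lt w) : a * u * b ∈ lower wt lt (a * w * b) :=
  ⟨hlt.mul_mul _ _ _ _ h.1, by simp only [monDeg_mul, h.2]⟩

theorem lower_subset (hlt : IsMonomialOrder lt) {u w : Mon N} (h : u ∈ lower wt lt w) :
    lower wt lt u ⊆ lower wt lt w :=
  fun _ hv => ⟨hlt.trans hv.1 h.1, hv.2.trans h.2⟩

theorem not_mem_lower (hlt : IsMonomialOrder lt) (w : Mon N) : w ∉ lower wt lt w :=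
  fun h => hlt.irrefl w h.1

theorem HasDegree.sub_leading_mem (hlt : IsMonomialOrder lt) {g : FreeAlg K N} {q : ℕ}
    (hg : HasDegree wt g q) :
    g - LC lt g • mon K (LM lt g) ∈ supportedOn K (lower wt lt (LM lt g)) := by
  rw [mem_supportedOn]
  intro m hm
  have hne : m ≠ LM lt g := by
    rintro rfl
    simp [mon, LC] at hm
  have hm' : m ∈ g.coeff.support := by
    simpa [mon, Ne.symm hne] using hm
  exact ⟨(hlt.isLeadingMonomial_LM hg.1).2 m hm' hne, by rw [hg.2 m hm', hlt.monDeg_LM hg]⟩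

/-- An element whose monomials are at most `w` and whose coefficient at `w` is nonzero has
leading monomial `w`. -/
theorem LM_smul_add (hlt : IsMonomialOrder lt) {x : FreeAlg K N} {w : Mon N} {c : K} (hc : c ≠ 0)
    (hx : x - c • mon K w ∈ supportedOn K (lower wt lt w)) : LM lt x = w := by
  refine hlt.LM_eq ⟨?_, fun v hv hne => ?_⟩
  · have h := coeff_eq_zero_of_mem_supportedOn hx (not_mem_lower hlt w)
    rw [Finsupp.mem_support_iff]
    intro h0
    simp [mon, h0, hc] at h
  · refine (mem_supportedOn.1 hx v ?_).1
    simpa [mon, Ne.symm hne] using hv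

/-! ### Spans of multiples of a set -/

/-- The span of the multiples `a g b` with `g ∈ G` whose leading monomial lies in `S`. -/
noncomputable def multiples (lt : Mon N → Mon N → Prop) (G : Set (FreeAlg K N))
    (S : Set (Mon N)) : Submodule K (FreeAlg K N) :=
  Submodule.span K
    {x | ∃ g ∈ G, ∃ a b, a * LM lt g * b ∈ S ∧ x = mon K a * g * mon K b}

variable {G H : Set (FreeAlg K N)} {S T : Set (Mon N)}

theorem mul_mul_mem_multiples {g : FreeAlg K N} {a b : Mon N} (hg : g ∈ G)
    (h : a * LM lt g * b ∈ S) : mon K a * g * mon K b ∈ multiples lt G S :=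
  Submodule.subset_span ⟨g, hg, a, b, h, rfl⟩

theorem multiples_mono (hG : G ⊆ H) (hS : S ⊆ T) : multiples lt G S ≤ multiples lt H T :=
  Submodule.span_mono fun _ ⟨g, hg, a, b, h, hx⟩ => ⟨g, hG hg, a, b, hS h, hx⟩

theorem mon_mul_mul_mon_mem_multiples {x : FreeAlg K N} (a b : Mon N)
    (hx : x ∈ multiples lt G S) (h : ∀ m ∈ S, a * m * b ∈ T) :
    mon K a * x * mon K b ∈ multiples lt G T := by
  induction hx using Submodule.span_induction with
  | mem x hx =>
    obtain ⟨g, hg, c, d, hS, rfl⟩ := hx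
    have e : mon K a * (mon K c * g * mon K d) * mon K b
        = mon K (a * c) * g * mon K (d * b) := by
      simp only [← mon_mul, mul_assoc]
    rw [e]
    refine mul_mul_mem_multiples hg ?_
    simpa only [mul_assoc] using h _ hS
  | zero => simp
  | add x y _ _ hx hy =>
    rw [mul_add, add_mul]
    exact add_mem hx hy
  | smul c x _ hx =>
    rw [mul_smul_comm, smul_mul_assoc]
    exact Submodule.smul_mem _ c hx

theorem mul_mem_multiples {g x : FreeAlg K N} (hg : g ∈ G) (hx : x ∈ supportedOn K S)
    (h : ∀ m ∈ S, LM lt g * m ∈ T) : g * x ∈ multiples lt G T := by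
  induction hx using Submodule.span_induction with
  | mem x hx =>
    obtain ⟨w, hw, rfl⟩ := hx
    have := mul_mul_mem_multiples (lt := lt) (S := T) (a := 1) (b := w) hg (by simpa using h w hw)
    simpa [mon_one] using this
  | zero => simp
  | add x y _ _ hx hy =>
    rw [mul_add]
    exact add_mem hx hy
  | smul c x _ hx =>
    rw [mul_smul_comm]
    exact Submodule.smul_mem _ c hx

theorem mul_mem_multiples' {g x : FreeAlg K N} (hg : g ∈ G) (hx : x ∈ supportedOn K S)
    (h : ∀ m ∈ S, m * LM lt g ∈ T) : x * g ∈ multiples lt G T := by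
  induction hx using Submodule.span_induction with
  | mem x hx =>
    obtain ⟨w, hw, rfl⟩ := hx
    have := mul_mul_mem_multiples (lt := lt) (S := T) (a := w) (b := 1) hg (by simpa using h w hw)
    simpa [mon_one] using this
  | zero => simp
  | add x y _ _ hx hy =>
    rw [add_mul]
    exact add_mem hx hy
  | smul c x _ hx =>
    rw [smul_mul_assoc]
    exact Submodule.smul_mem _ c hx

/-- The monomials of a homogeneous element are its leading monomial and monomials below it. -/
theorem HasDegree.mem_supportedOn (hlt : IsMonomialOrder lt) {g : FreeAlg K N} {q : ℕ}
    (hg : HasDegree wt g q) : g ∈ supportedOn K {m | m = LM lt g ∨ m ∈ lower wt lt (LM lt g)} := by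
  have h := add_mem (supportedOn_mono (fun m hm => Or.inr hm) (hg.sub_leading_mem hlt))
    (Submodule.smul_mem _ (LC lt g)
      (mon_mem_supportedOn (S := {m | m = LM lt g ∨ m ∈ lower wt lt (LM lt g)}) (Or.inl rfl)))
  rwa [sub_add_cancel] at h

/-- By homogeneity, every other monomial of `a g b` is smaller than its leading word and of the same
degree. -/
theorem multiples_le_supportedOn (hlt : IsMonomialOrder lt)
    (hG : ∀ g ∈ G, ∃ q, HasDegree wt g q) (hS : ∀ w ∈ S, lower wt lt w ⊆ S) :
    multiples lt G S ≤ supportedOn K S := by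
  refine Submodule.span_le.2 ?_
  rintro _ ⟨g, hg, a, b, hab, rfl⟩
  obtain ⟨q, hq⟩ := hG g hg
  refine mon_mul_mul_mon_mem_supportedOn a b (hq.mem_supportedOn hlt) ?_
  rintro m (rfl | hm)
  · exact hab
  · exact hS _ hab (lower_mul_mem hlt a b hm)

end FreeGB

namespace FreeGB

variable {K : Type*} [Field K] {N : ℕ} {wt : Fin N → ℕ} {lt : Mon N → Mon N → Prop}
  {G : Set (FreeAlg K N)} {n : ℕ}

/-! ### Overlaps and leading monomials -/

/-- A set of homogeneous elements with incomparable leading monomials whose overlap elements up to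
degree `n` are combinations of multiples with smaller leading monomials. -/
structure Confluent (wt : Fin N → ℕ) (lt : Mon N → Mon N → Prop) (n : ℕ)
    (G : Set (FreeAlg K N)) : Prop where
  homogeneous : ∀ g ∈ G, ∃ q, HasDegree wt g q
  incomparable : ∀ g ∈ G, ∀ h ∈ G, Divides (LM lt g) (LM lt h) → g = h
  overlap : ∀ g ∈ G, ∀ h ∈ G, ∀ u v, LM lt g * u = v * LM lt h →
    ¬ Divides (LM lt g) v → ¬ Divides (LM lt h) u → monDeg wt (LM lt g * u) ≤ n →
    (LC lt g)⁻¹ • (g * mon K u) - (LC lt h)⁻¹ • (mon K v * h) ∈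
      multiples lt G (lower wt lt (LM lt g * u))

theorem inv_LC_smul_sub_mem (hlt : IsMonomialOrder lt) {g : FreeAlg K N} {q : ℕ}
    (hg : HasDegree wt g q) :
    (LC lt g)⁻¹ • g - mon K (LM lt g) ∈ supportedOn K (lower wt lt (LM lt g)) := by
  have h := Submodule.smul_mem _ (LC lt g)⁻¹ (hg.sub_leading_mem hlt)
  rwa [smul_sub, smul_smul, inv_mul_cancel₀ (hlt.LC_ne_zero hg.1), one_smul] at h

/-- Two multiples of elements of `G` whose leading monomials sit at disjoint places. -/
theorem disjoint_sub_mem (hlt : IsMonomialOrder lt) (hG : ∀ g ∈ G, ∃ q, HasDegree wt g q)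
    {g h : FreeAlg K N} (hg : g ∈ G) (hh : h ∈ G) (e : Mon N) :
    (LC lt g)⁻¹ • (g * mon K (e * LM lt h)) - (LC lt h)⁻¹ • (mon K (LM lt g * e) * h) ∈
      multiples lt G (lower wt lt (LM lt g * e * LM lt h)) := by
  obtain ⟨q, hq⟩ := hG g hg
  obtain ⟨q', hq'⟩ := hG h hh
  have hs := inv_LC_smul_sub_mem hlt hq
  have ht := inv_LC_smul_sub_mem hlt hq'
  set s := (LC lt g)⁻¹ • g - mon K (LM lt g) with hs'
  set t := (LC lt h)⁻¹ • h - mon K (LM lt h) with ht'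
  have h₁ : g * (mon K e * t * mon K 1) ∈
      multiples lt G (lower wt lt (LM lt g * e * LM lt h)) := by
    refine mul_mem_multiples hg (mon_mul_mul_mon_mem_supportedOn e 1 ht
      (fun m hm => lower_mul_mem hlt e 1 hm)) fun m hm => ?_
    simpa only [mul_one, mul_assoc] using lower_mul_mem hlt (LM lt g) 1 hm
  have h₂ : (mon K 1 * s * mon K e) * h ∈
      multiples lt G (lower wt lt (LM lt g * e * LM lt h)) := by
    refine mul_mem_multiples' hh (mon_mul_mul_mon_mem_supportedOn 1 e hs
      (fun m hm => lower_mul_mem hlt 1 e hm)) fun m hm => ?_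
    simpa only [one_mul, mul_assoc] using lower_mul_mem hlt 1 (LM lt h) hm
  -- With normalised `g' = LM g + s` and `h' = LM h + t`, both sides are `g' e LM h - LM g e h' = s
  -- e h' - g' e t`, the term `g' e h'` cancelling.
  have key : (LC lt g)⁻¹ • (g * mon K (e * LM lt h)) - (LC lt h)⁻¹ • (mon K (LM lt g * e) * h) =
      (LC lt h)⁻¹ • (mon K 1 * s * mon K e * h) - (LC lt g)⁻¹ • (g * (mon K e * t * mon K 1)) := by
    simp only [hs', ht', mon_one, ← mon_mul, one_mul, mul_one, sub_mul, mul_sub, smul_sub,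
      smul_mul_assoc, mul_smul_comm, mul_assoc]
    rw [smul_comm]
    abel
  rw [key]
  exact sub_mem (Submodule.smul_mem _ _ h₂) (Submodule.smul_mem _ _ h₁)

/-! ### Buchberger's criterion in bounded degree -/

namespace Confluent

variable (hlt : IsMonomialOrder lt) (hG : Confluent wt lt n G)
include hlt hG

/-- The occurrence of `LM g` starts the word, so only the place of `LM h` matters: after `LM g`,
inside it, or across its end. Incomparability settles the second case, the overlap condition the
third. -/
theorem sub_mem_of_left {g h : FreeAlg K N} (hg : g ∈ G) (hh : h ∈ G) {b c d : Mon N}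
    (heq : LM lt g * b = c * LM lt h * d) (hn : monDeg wt (LM lt g * b) ≤ n) :
    (LC lt g)⁻¹ • (g * mon K b) - (LC lt h)⁻¹ • (mon K c * h * mon K d) ∈
      multiples lt G (lower wt lt (LM lt g * b)) := by
  rcases mul_eq_mul_cases (heq.trans (mul_assoc c _ d)) with ⟨e, rfl, rfl⟩ | ⟨e, he, he'⟩
  · have h₁ := mon_mul_mul_mon_mem_multiples 1 d (disjoint_sub_mem hlt hG.homogeneous hg hh e)
      (fun m hm => lower_mul_mem hlt 1 d hm)
    simpa only [mon_one, one_mul, sub_mul, smul_mul_assoc, mul_assoc, mon_mul] using h₁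
  · rcases mul_eq_mul_cases he' with ⟨u, rfl, rfl⟩ | ⟨u, hu, rfl⟩
    · obtain rfl : h = g := hG.incomparable h hh g hg ⟨c, u, by rw [he, mul_assoc]⟩
      obtain ⟨rfl, rfl⟩ := eq_one_of_eq_mul_mul (he.trans (mul_assoc _ _ _).symm)
      simp [mon_one]
    · by_cases h1 : e = 1
      · subst h1
        rw [mul_one] at he
        rw [one_mul] at hu
        subst he hu
        have h₁ := mon_mul_mul_mon_mem_multiples 1 d
          (disjoint_sub_mem hlt hG.homogeneous hg hh 1) (fun m hm => lower_mul_mem hlt 1 d hm)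
        simpa only [mon_one, one_mul, mul_one, sub_mul, smul_mul_assoc, mul_assoc, mon_mul]
          using h₁
      have hlen : e.length ≠ 0 := fun h => h1 (FreeMonoid.length_eq_zero.1 h)
      have hc := congrArg FreeMonoid.length he
      have hl := congrArg FreeMonoid.length hu
      simp only [FreeMonoid.length_mul] at hc hl
      -- The common part `e` is nonempty, so `c` is shorter than `LM g` and `u` shorter than `LM h`;
      -- this rules out both divisibilities.
      have h₁ := hG.overlap g hg h hh u c (by rw [he, hu, mul_assoc])
        (fun hd => by have := hd.length_le; omega) (fun hd => by have := hd.length_le; omega)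
        (by simp only [monDeg_mul] at hn ⊢; omega)
      have h₂ := mon_mul_mul_mon_mem_multiples 1 d h₁ (fun m hm => lower_mul_mem hlt 1 d hm)
      simpa only [mon_one, one_mul, sub_mul, smul_mul_assoc, mul_assoc, mon_mul] using h₂

theorem sub_mem {g h : FreeAlg K N} (hg : g ∈ G) (hh : h ∈ G) {a b c d w : Mon N}
    (hab : a * LM lt g * b = w) (hcd : c * LM lt h * d = w) (hn : monDeg wt w ≤ n) :
    (LC lt g)⁻¹ • (mon K a * g * mon K b) - (LC lt h)⁻¹ • (mon K c * h * mon K d) ∈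
      multiples lt G (lower wt lt w) := by
  -- The common left factor `a` is stripped off, so that one occurrence starts the word. The claim
  -- is symmetric up to sign, so either occurrence may be the left one.
  have aux : ∀ {g h : FreeAlg K N}, g ∈ G → h ∈ G → ∀ {a b e d : Mon N},
      a * LM lt g * b = w → LM lt g * b = e * (LM lt h * d) →
      (LC lt g)⁻¹ • (mon K a * g * mon K b) - (LC lt h)⁻¹ • (mon K (a * e) * h * mon K d) ∈
        multiples lt G (lower wt lt w) := by
    intro g h hg hh a b e d hw he
    rw [mul_assoc] at hw
    have h₁ := mon_mul_mul_mon_mem_multiples a 1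
      (hG.sub_mem_of_left hlt hg hh (he.trans (mul_assoc _ _ _).symm)
        (by rw [← hw, monDeg_mul] at hn; omega))
      (fun m hm => lower_mul_mem hlt a 1 hm)
    rw [mul_one, hw] at h₁
    simpa only [mon_one, mul_one, mul_sub, mul_smul_comm, ← mul_assoc, mon_mul] using h₁
  rcases mul_eq_mul_cases ((mul_assoc a _ b).symm.trans (hab.trans (hcd.symm.trans
    (mul_assoc c _ d)))) with ⟨e, rfl, he⟩ | ⟨e, rfl, he⟩
  · exact aux hg hh hab he
  · rw [← neg_mem_iff, neg_sub]
    exact aux hh hg hcd he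

/-- A combination of multiples of `G` is zero, or a multiple of a single `a g b` up to smaller
ones. -/
theorem exists_leading {S : Set (Mon N)} {q : ℕ} (hq : q ≤ n) (hS : ∀ m ∈ S, monDeg wt m = q)
    {x : FreeAlg K N} (hx : x ∈ multiples lt G S) :
    x = 0 ∨ ∃ c : K, ∃ g ∈ G, ∃ a b, a * LM lt g * b ∈ S ∧
      x - c • ((LC lt g)⁻¹ • (mon K a * g * mon K b)) ∈
        multiples lt G (lower wt lt (a * LM lt g * b)) := by
  induction hx using Submodule.span_induction with
  | mem x hx =>
    obtain ⟨g, hg, a, b, hab, rfl⟩ := hx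
    obtain ⟨q, hgq⟩ := hG.homogeneous g hg
    refine Or.inr ⟨LC lt g, g, hg, a, b, hab, ?_⟩
    rw [smul_smul, mul_inv_cancel₀ (hlt.LC_ne_zero hgq.1), one_smul, sub_self]
    exact zero_mem _
  | zero => exact Or.inl rfl
  | smul k x _ hx =>
    rcases hx with rfl | ⟨c, g, hg, a, b, hab, h⟩
    · exact Or.inl (smul_zero k)
    · refine Or.inr ⟨k * c, g, hg, a, b, hab, ?_⟩
      rw [mul_smul, ← smul_sub]
      exact Submodule.smul_mem _ _ h
  | add x y _ _ hx hy =>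
    rcases hx with rfl | ⟨c, g, hg, a, b, hab, hx⟩
    · rwa [zero_add]
    rcases hy with rfl | ⟨c', g', hg', a', b', hab', hy⟩
    · rw [add_zero]
      exact Or.inr ⟨c, g, hg, a, b, hab, hx⟩
    right
    have absorb : ∀ {x : FreeAlg K N} {c : K} {g : FreeAlg K N} {a b w : Mon N}, g ∈ G →
        x - c • ((LC lt g)⁻¹ • (mon K a * g * mon K b)) ∈
          multiples lt G (lower wt lt (a * LM lt g * b)) →
        a * LM lt g * b ∈ lower wt lt w → x ∈ multiples lt G (lower wt lt w) := by
      intro x c g a b w hg h hw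
      have := add_mem (multiples_mono subset_rfl (lower_subset hlt hw) h)
        (Submodule.smul_mem _ c (Submodule.smul_mem _ (LC lt g)⁻¹
          (mul_mul_mem_multiples hg hw)))
      rwa [sub_add_cancel] at this
    rcases hlt.cases (a * LM lt g * b) (a' * LM lt g' * b') with hl | he | hl
    · refine ⟨c', g', hg', a', b', hab', ?_⟩
      rw [add_sub_assoc]
      exact add_mem (absorb hg hx ⟨hl, (hS _ hab).trans (hS _ hab').symm⟩) hy
    · refine ⟨c + c', g, hg, a, b, hab, ?_⟩
      rw [← he] at hy
      -- Equal leading words: the second multiple is traded for the first, at the cost of lower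
      -- terms. The sum `c + c'` may vanish, which the conclusion allows.
      have hcrit := Submodule.smul_mem _ c'
        (hG.sub_mem hlt hg hg' rfl he.symm ((hS _ hab).trans_le hq))
      have := _root_.sub_mem (add_mem hx hy) hcrit
      rw [smul_sub] at this
      convert this using 1
      rw [add_smul]
      abel
    · refine ⟨c, g, hg, a, b, hab, ?_⟩
      rw [add_sub_right_comm]
      exact add_mem hx (absorb hg' hy ⟨hl, (hS _ hab').trans (hS _ hab).symm⟩)

/-- The leading monomial of a combination of multiples of `G` of degree `q ≤ n` is divisible by
the leading monomial of an element of `G`. -/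
theorem divides_LM {S : Set (Mon N)} {q : ℕ} (hq : q ≤ n) (hS : ∀ m ∈ S, monDeg wt m = q)
    {x : FreeAlg K N} (hx0 : x ≠ 0) (hx : x ∈ multiples lt G S) :
    ∃ g ∈ G, Divides (LM lt g) (LM lt x) := by
  obtain h | ⟨c, g, hg, a, b, hab, h⟩ := hG.exists_leading hlt hq hS hx
  · exact absurd h hx0
  have hwq := hS _ hab
  -- During the descent only the degree of the leading word is kept, not its membership in `S`.
  clear hab
  generalize hw : a * LM lt g * b = w at hwq h
  induction w using hlt.wf.induction generalizing c g a b with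
  | _ w ih =>
  -- If the top coefficient has cancelled, `x` is a combination of multiples below `w`, and the
  -- induction descends. Otherwise nothing can cancel `w`.
  by_cases hc : c = 0
  · rw [hc, zero_smul, sub_zero] at h
    obtain h | ⟨c', g', hg', a', b', hab', h'⟩ :=
      hG.exists_leading hlt hq (fun m hm => hm.2.trans hwq) h
    · exact absurd h hx0
    · exact ih _ hab'.1 c' g' hg' a' b' rfl (hab'.2.trans hwq) h'
  · refine ⟨g, hg, a, b, ?_⟩
    obtain ⟨q', hgq⟩ := hG.homogeneous g hg
    rw [hw]
    refine LM_smul_add (wt := wt) hlt hc ?_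
    have h₁ := multiples_le_supportedOn hlt hG.homogeneous (fun m hm => lower_subset hlt hm) h
    have h₂ := Submodule.smul_mem _ c (mon_mul_mul_mon_mem_supportedOn a b
      (inv_LC_smul_sub_mem hlt hgq) (fun m hm => lower_mul_mem hlt a b hm))
    rw [hw] at h₂
    convert add_mem h₁ h₂ using 1
    rw [mul_sub, sub_mul, mul_smul_comm, smul_mul_assoc, mon_mul, mon_mul, hw, smul_sub]
    abel

end Confluent

end FreeGB

namespace FreeGB

variable {K : Type*} [Field K] {N : ℕ} {wt : Fin N → ℕ} {lt : Mon N → Mon N → Prop}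
  {G H : Set (FreeAlg K N)} {n : ℕ}

/-! ### Two-sided ideals and homogeneous components -/

theorem smul_mem_ideal (c : K) {x : FreeAlg K N} {I : TwoSidedIdeal (FreeAlg K N)} (hx : x ∈ I) :
    c • x ∈ I := by
  rw [Algebra.smul_def]
  exact I.mul_mem_left _ _ hx

theorem mem_multiples_of_mem_ideal (lt : Mon N → Mon N → Prop) {x : FreeAlg K N}
    (hx : x ∈ ideal G) : x ∈ multiples lt G Set.univ := by
  induction hx using TwoSidedIdeal.span_induction with
  | mem x hx =>
    simpa [mon_one] using
      mul_mul_mem_multiples (lt := lt) (S := Set.univ) (a := 1) (b := 1) hx trivial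
  | zero => exact zero_mem _
  | add x y _ _ hx hy => exact add_mem hx hy
  | neg x _ hx => exact neg_mem hx
  | left_absorb a x _ hx =>
    induction a using MonoidAlgebra.induction_linear with
    | zero => simp
    | add a b ha hb =>
      rw [add_mul]
      exact add_mem ha hb
    | single m c =>
      rw [single_eq_smul_mon, smul_mul_assoc]
      refine Submodule.smul_mem _ _ ?_
      simpa [mon_one] using
        mon_mul_mul_mon_mem_multiples (T := Set.univ) m 1 hx (fun _ _ => trivial)
  | right_absorb b x _ hx =>
    induction b using MonoidAlgebra.induction_linear with
    | zero => simp
    | add a b ha hb =>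
      rw [mul_add]
      exact add_mem ha hb
    | single m c =>
      rw [single_eq_smul_mon, mul_smul_comm]
      refine Submodule.smul_mem _ _ ?_
      simpa [mon_one] using
        mon_mul_mul_mon_mem_multiples (T := Set.univ) 1 m hx (fun _ _ => trivial)

theorem HasDegree.unique {x : FreeAlg K N} {q q' : ℕ} (h : HasDegree wt x q)
    (h' : HasDegree wt x q') : q = q' := by
  have hne : x.coeff.support.Nonempty := by
    rw [Finsupp.support_nonempty_iff, Ne, MonoidAlgebra.coeff_eq_zero]
    exact h.1
  obtain ⟨m, hm⟩ := hne
  exact (h.2 m hm).symm.trans (h'.2 m hm)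

/-- A representation of an ideal element may mix degrees. Each multiple `a g b` is homogeneous, so
those of degree `q` can be singled out and represent the component of degree `q`. -/
theorem exists_component (hlt : IsMonomialOrder lt) (hG : ∀ g ∈ G, ∃ q, HasDegree wt g q) (q : ℕ)
    {x : FreeAlg K N} (hx : x ∈ multiples lt G Set.univ) :
    ∃ y ∈ multiples lt G {m | monDeg wt m = q},
      ∀ m, y.coeff m = if monDeg wt m = q then x.coeff m else 0 := by
  induction hx using Submodule.span_induction with
  | mem x hx =>
    obtain ⟨g, hg, a, b, -, rfl⟩ := hx
    obtain ⟨d, hd⟩ := hG g hg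
    have hs : mon K a * g * mon K b ∈
        supportedOn K {m | monDeg wt m = monDeg wt (a * LM lt g * b)} :=
      mon_mul_mul_mon_mem_supportedOn a b (mem_supportedOn.2 hd.2) fun m hm => by
        simp only [Set.mem_ofPred_eq, monDeg_mul, hlt.monDeg_LM hd]
        rw [show monDeg wt m = d from hm]
    by_cases h : monDeg wt (a * LM lt g * b) = q
    · refine ⟨_, mul_mul_mem_multiples hg h, fun m => ?_⟩
      split_ifs with hm
      · rfl
      · exact coeff_eq_zero_of_mem_supportedOn hs fun hm' => hm (hm'.trans h)
    · refine ⟨0, zero_mem _, fun m => ?_⟩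
      split_ifs with hm
      · exact (coeff_eq_zero_of_mem_supportedOn hs fun hm' => h (hm'.symm.trans hm)).symm
      · rfl
  | zero => exact ⟨0, zero_mem _, by simp⟩
  | add x y _ _ hx hy =>
    obtain ⟨x', hx', hx⟩ := hx
    obtain ⟨y', hy', hy⟩ := hy
    refine ⟨x' + y', add_mem hx' hy', fun m => ?_⟩
    rw [MonoidAlgebra.coeff_add, Finsupp.add_apply, hx, hy]
    split_ifs <;> simp
  | smul c x _ hx =>
    obtain ⟨x', hx', hx⟩ := hx
    refine ⟨c • x', Submodule.smul_mem _ c hx', fun m => ?_⟩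
    rw [MonoidAlgebra.coeff_smul, Finsupp.smul_apply, hx]
    split_ifs <;> simp

theorem HasDegree.mem_multiples (hlt : IsMonomialOrder lt) (hG : ∀ g ∈ G, ∃ q, HasDegree wt g q)
    {q : ℕ} {x : FreeAlg K N} (hxq : HasDegree wt x q) (hx : x ∈ ideal G) :
    x ∈ multiples lt G {m | monDeg wt m = q} := by
  obtain ⟨y, hy, hxy⟩ := exists_component hlt hG q (mem_multiples_of_mem_ideal lt hx)
  have : y = x := by
    ext m
    rw [hxy]
    split_ifs with hm
    · rfl
    · by_contra h
      exact hm (hxq.2 m (Finsupp.mem_support_iff.2 (Ne.symm h)))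
  exact this ▸ hy

/-! ### Overlap elements -/

theorem IsOverlap.mem_ideal {f g h : FreeAlg K N} (ho : IsOverlap lt f g h)
    {I : TwoSidedIdeal (FreeAlg K N)} (hf : f ∈ I) (hg : g ∈ I) : h ∈ I := by
  obtain ⟨-, -, u, v, -, -, -, rfl⟩ := ho
  exact sub_mem (smul_mem_ideal _ (I.mul_mem_right _ _ hf))
    (smul_mem_ideal _ (I.mul_mem_left _ _ hg))

/-- Both normalised products have the leading word `LM f * u = v * LM g` with coefficient 1, so it
cancels. -/
theorem overlap_mem_lower (hlt : IsMonomialOrder lt) {f g : FreeAlg K N} {p q : ℕ}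
    (hf : HasDegree wt f p) (hg : HasDegree wt g q) {u v : Mon N}
    (h : LM lt f * u = v * LM lt g) :
    (LC lt f)⁻¹ • (f * mon K u) - (LC lt g)⁻¹ • (mon K v * g) ∈
      supportedOn K (lower wt lt (LM lt f * u)) := by
  have h₁ := mon_mul_mul_mon_mem_supportedOn 1 u (inv_LC_smul_sub_mem hlt hf)
    (fun m hm => lower_mul_mem hlt 1 u hm)
  have h₂ := mon_mul_mul_mon_mem_supportedOn v 1 (inv_LC_smul_sub_mem hlt hg)
    (fun m hm => lower_mul_mem hlt v 1 hm)
  simp only [mon_one, one_mul, mul_one] at h₁ h₂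
  rw [← h] at h₂
  convert sub_mem h₁ h₂ using 1
  simp only [sub_mul, mul_sub, mon_mul, h, smul_mul_assoc, mul_smul_comm]
  abel

/-- Since `LM f` does not divide `v`, the two leading monomials really overlap. The lengths of `v`
and of the common part then determine the overlap element. -/
theorem IsOverlap.finite (f g : FreeAlg K N) : {h | IsOverlap lt f g h}.Finite := by
  refine (((Finset.range (LM lt f).length ×ˢ Finset.range ((LM lt g).length + 1)).finite_toSet).image
    fun ij => (LC lt f)⁻¹ • (f * mon K (FreeMonoid.ofList ((LM lt g).toList.drop ij.2))) -
      (LC lt g)⁻¹ • (mon K (FreeMonoid.ofList ((LM lt f).toList.take ij.1)) * g)).subset ?_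
  rintro _ ⟨-, -, u, v, he, hv, hu, rfl⟩
  rcases mul_eq_mul_cases he with ⟨e, rfl, -⟩ | ⟨e, he', hg⟩
  · exact absurd ⟨1, e, by simp⟩ hv
  · refine ⟨(v.length, e.length), ?_, ?_⟩
    · have h₁ := congrArg FreeMonoid.length he'
      have h₂ := congrArg FreeMonoid.length hg
      have h₃ : e.length ≠ 0 := fun h => by
        rw [FreeMonoid.length_eq_zero.1 h, mul_one] at he'
        exact hv (he' ▸ divides_refl _)
      simp only [FreeMonoid.length_mul] at h₁ h₂
      simp only [Finset.coe_product, Set.mem_prod, Finset.mem_coe, Finset.mem_range]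
      omega
    · have h₁ : (LM lt g).toList.drop e.length = u.toList := by
        rw [hg, FreeMonoid.toList_mul]
        exact List.drop_left
      have h₂ : (LM lt f).toList.take v.length = v.toList := by
        rw [he', FreeMonoid.toList_mul]
        exact List.take_left
      simp only [h₁, h₂, FreeMonoid.ofList_toList]

theorem newOverlaps_finite (n₀ : ℕ) (L : List (FreeAlg K N)) (r : FreeAlg K N) :
    (newOverlaps wt lt n₀ L r).Finite := by
  have h : (⋃ g ∈ {g | g ∈ L}, ({h | IsOverlap lt g r h} ∪ {h | IsOverlap lt r g h})).Finite :=
    (List.finite_toSet L).biUnion fun g _ => (IsOverlap.finite g r).union (IsOverlap.finite r g)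
  refine (h.union (IsOverlap.finite (lt := lt) r r)).subset ?_
  rintro x ⟨⟨g, hg, hx⟩ | hx, -⟩
  · exact Or.inl (Set.mem_biUnion hg hx)
  · exact Or.inr hx

/-! ### Division -/

/-- Whenever the monomials of `h` are below `w`, so are those of `p` and `r`, and `h - p - r` is a
combination of multiples of `G` with leading monomials below `w`. -/
def PartiallyResolved (wt : Fin N → ℕ) (lt : Mon N → Mon N → Prop) (G : Set (FreeAlg K N))
    (h p r : FreeAlg K N) : Prop :=
  ∀ w, h ∈ supportedOn K (lower wt lt w) → p ∈ supportedOn K (lower wt lt w) ∧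
    r ∈ supportedOn K (lower wt lt w) ∧ h - p - r ∈ multiples lt G (lower wt lt w)

/-- Whenever the monomials of `h` are below `w`, it is a combination of multiples of `G` with
leading monomials below `w`. -/
def Resolved (wt : Fin N → ℕ) (lt : Mon N → Mon N → Prop) (G : Set (FreeAlg K N))
    (h : FreeAlg K N) : Prop :=
  ∀ w, h ∈ supportedOn K (lower wt lt w) → h ∈ multiples lt G (lower wt lt w)

theorem Resolved.mono {h : FreeAlg K N} (hr : Resolved wt lt G h) (hGH : G ⊆ H) :
    Resolved wt lt H h :=
  fun w hw => multiples_mono hGH subset_rfl (hr w hw)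

theorem partiallyResolved_self (h : FreeAlg K N) : PartiallyResolved wt lt G h h 0 :=
  fun w hw => ⟨hw, zero_mem _, by simp⟩

theorem PartiallyResolved.resolved_of_zero {h : FreeAlg K N}
    (hr : PartiallyResolved wt lt G h 0 0) : Resolved wt lt G h :=
  fun w hw => by simpa using (hr w hw).2.2

/-- The remainder stays below the same `w` as `h`, so as an element of `H` it is itself an
admissible multiple. -/
theorem PartiallyResolved.resolved (hlt : IsMonomialOrder lt) {h r : FreeAlg K N}
    (hr : PartiallyResolved wt lt G h 0 r) (hGH : G ⊆ H) (hrH : r ∈ H) (hr0 : r ≠ 0) :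
    Resolved wt lt H h := by
  intro w hw
  obtain ⟨-, h₁, h₂⟩ := hr w hw
  have h₃ : r ∈ multiples lt H (lower wt lt w) := by
    have := mul_mul_mem_multiples (lt := lt) (S := lower wt lt w) (a := 1) (b := 1) hrH
      (by simpa using mem_supportedOn.1 h₁ _ (hlt.isLeadingMonomial_LM hr0).1)
    simpa [mon_one] using this
  have := add_mem (multiples_mono hGH subset_rfl h₂) h₃
  simpa using this

/-- `r` has no monomial divisible by a leading monomial of an element of `G`. -/
def Reduced (lt : Mon N → Mon N → Prop) (G : Set (FreeAlg K N)) (r : FreeAlg K N) : Prop :=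
  ∀ m ∈ r.coeff.support, ∀ g ∈ G, ¬ Divides (LM lt g) m

namespace DivStep

variable {L : List (FreeAlg K N)} {p r p' r' : FreeAlg K N}

theorem ne_zero (h : DivStep lt L (p, r) (p', r')) : p ≠ 0 := by
  cases h <;> assumption

theorem mem_lower (hlt : IsMonomialOrder lt) (hL : ∀ g ∈ L, ∃ q, HasDegree wt g q) {q : ℕ}
    (hp : HasDegree wt p q) (h : DivStep lt L (p, r) (p', r')) :
    p' ∈ supportedOn K (lower wt lt (LM lt p)) := by
  cases h with
  | cancel _ _ g a b hp0 hg h =>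
    obtain ⟨d, hd⟩ := hL g hg
    have h₁ := hp.sub_leading_mem hlt
    have h₂ := Submodule.smul_mem _ (LC lt p) (mon_mul_mul_mon_mem_supportedOn a b
      (inv_LC_smul_sub_mem hlt hd) (fun m hm => lower_mul_mem hlt a b hm))
    rw [← h] at h₂
    convert sub_mem h₁ h₂ using 1
    rw [mul_sub, sub_mul, mul_smul_comm, smul_mul_assoc, mon_mul, mon_mul, ← h, smul_sub,
      smul_smul, div_eq_mul_inv]
    abel
  | move _ _ hp0 h =>
    rw [single_eq_smul_mon]
    exact hp.sub_leading_mem hlt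

theorem mem_ideal (h : DivStep lt L (p, r) (p', r')) :
    p + r - (p' + r') ∈ ideal {g | g ∈ L} := by
  cases h with
  | cancel _ _ g a b hp0 hg h =>
    have h₁ : (LC lt p / LC lt g) • (mon K a * g * mon K b) ∈ ideal {g | g ∈ L} :=
      smul_mem_ideal _ ((ideal _).mul_mem_right _ _ ((ideal _).mul_mem_left _ _
        (TwoSidedIdeal.subset_span hg)))
    convert h₁ using 1
    abel
  | move _ _ hp0 h =>
    convert zero_mem (ideal {g | g ∈ L}) using 1
    abel

/-- The leading monomial of `p` is below `w`, so the multiple subtracted to cancel it, or the term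
moved to `r`, is below `w` as well. -/
theorem partiallyResolved (hlt : IsMonomialOrder lt) (hL : ∀ g ∈ L, ∃ q, HasDegree wt g q)
    {x : FreeAlg K N} (hx : PartiallyResolved wt lt {g | g ∈ L} x p r)
    (h : DivStep lt L (p, r) (p', r')) : PartiallyResolved wt lt {g | g ∈ L} x p' r' := by
  intro w hw
  obtain ⟨h₁, h₂, h₃⟩ := hx w hw
  have hp := mem_supportedOn.1 h₁ _ (hlt.isLeadingMonomial_LM h.ne_zero).1
  cases h with
  | cancel _ _ g a b hp0 hg h =>
    rw [h] at hp
    have h₄ := Submodule.smul_mem _ (LC lt p / LC lt g)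
      (mul_mul_mem_multiples (G := {g | g ∈ L}) hg hp)
    have h₅ := multiples_le_supportedOn hlt hL (fun m hm => lower_subset hlt hm) h₄
    refine ⟨sub_mem h₁ h₅, h₂, ?_⟩
    convert add_mem h₃ h₄ using 1
    abel
  | move _ _ hp0 h =>
    have h₄ : MonoidAlgebra.single (LM lt p) (LC lt p) ∈ supportedOn K (lower wt lt w) := by
      rw [single_eq_smul_mon]
      exact Submodule.smul_mem _ _ (mon_mem_supportedOn hp)
    refine ⟨sub_mem h₁ h₄, add_mem h₂ h₄, ?_⟩
    convert h₃ using 1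
    abel

theorem remainder_mem {S : Set (Mon N)} (hlt : IsMonomialOrder lt)
    (hp : p ∈ supportedOn K S) (hr : r ∈ supportedOn K S) (h : DivStep lt L (p, r) (p', r')) :
    r' ∈ supportedOn K S := by
  cases h with
  | cancel _ _ g a b hp0 hg h => exact hr
  | move _ _ hp0 h =>
    refine add_mem hr ?_
    rw [single_eq_smul_mon]
    exact Submodule.smul_mem _ _
      (mon_mem_supportedOn (mem_supportedOn.1 hp _ (hlt.isLeadingMonomial_LM hp0).1))

theorem reduced (hr : Reduced lt {g | g ∈ L} r) (h : DivStep lt L (p, r) (p', r')) :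
    Reduced lt {g | g ∈ L} r' := by
  cases h with
  | cancel _ _ g a b hp0 hg h => exact hr
  | move _ _ hp0 h =>
    intro m hm
    by_cases hmr : m ∈ r.coeff.support
    · exact hr m hmr
    · have : m = LM lt p := by
        by_contra hne
        rw [Finsupp.notMem_support_iff] at hmr
        simp [hmr, Ne.symm hne] at hm
      exact this ▸ h

theorem exists_step (r : FreeAlg K N) (hp : p ≠ 0) : ∃ p' r', DivStep lt L (p, r) (p', r') := by
  by_cases h : ∃ g ∈ L, Divides (LM lt g) (LM lt p)
  · obtain ⟨g, hg, a, b, h⟩ := h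
    exact ⟨_, _, .cancel p r g a b hp hg h⟩
  · push Not at h
    exact ⟨_, _, .move p r hp h⟩

end DivStep

open Classical in
/-- How far a polynomial is from having been divided completely. -/
noncomputable def divRank (hlt : IsMonomialOrder lt) (p : FreeAlg K N) : Ordinal.{0} :=
  haveI := hlt.wellOrder
  -- The successor separates zero from a nonzero constant, whose leading monomial has rank 0.
  if p = 0 then 0 else Order.succ (IsWellFounded.rank lt (LM lt p))

theorem divRank_lt (hlt : IsMonomialOrder lt) {p p' : FreeAlg K N} (hp : p ≠ 0)
    (h : p' ∈ supportedOn K (lower wt lt (LM lt p))) : divRank hlt p' < divRank hlt p := by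
  have := hlt.wellOrder
  unfold divRank
  rw [if_neg hp]
  split_ifs with hp'
  · exact Order.bot_lt_succ _
  · exact Order.succ_lt_succ (IsWellFounded.rank_lt_of_rel
      (mem_supportedOn.1 h _ (hlt.isLeadingMonomial_LM hp').1).1)

end FreeGB

namespace FreeGB

variable {K : Type*} [Field K] {N : ℕ} {wt : Fin N → ℕ} {lt : Mon N → Mon N → Prop}
  {n₀ : ℕ} {F : Set (FreeAlg K N)}

/-! ### The invariant of the algorithm -/

/-- What holds throughout the algorithm, where `k` is a strict upper bound of the degrees already
dealt with. -/
structure Invariant (wt : Fin N → ℕ) (lt : Mon N → Mon N → Prop) (n₀ : ℕ)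
    (F : Set (FreeAlg K N)) (k : ℕ) (s : State K N) : Prop where
  bound_le : k ≤ n₀ + 1
  W_subset : s.W ⊆ F
  W_degree : ∀ x ∈ s.W, ∀ q, HasDegree wt x q → k ≤ q
  Wn_subset : s.Wn ⊆ F
  -- The current round has degree `k - 1`, written as `q + 1 = k` so that nothing is being processed
  -- when `k = 0`.
  Wn_degree : ∀ x ∈ s.Wn, ∃ q, q + 1 = k ∧ HasDegree wt x q
  O_finite : s.O.Finite
  O_ideal : ∀ x ∈ s.O, x ∈ ideal F
  O_degree : ∀ x ∈ s.O, ∃ q, k ≤ q ∧ q ≤ n₀ ∧ HasDegree wt x q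
  On_finite : s.On.Finite
  On_ideal : ∀ x ∈ s.On, x ∈ ideal F
  On_degree : ∀ x ∈ s.On, ∃ q, q + 1 = k ∧ HasDegree wt x q
  G_ideal : ∀ g ∈ s.G, g ∈ ideal F
  G_degree : ∀ g ∈ s.G, ∃ q, q < k ∧ HasDegree wt g q
  G_sorted : s.G.Pairwise fun g h => monDeg wt (LM lt g) ≤ monDeg wt (LM lt h)
  G_incomparable : ∀ g ∈ s.G, ∀ h ∈ s.G, Divides (LM lt g) (LM lt h) → g = h
  -- The life of an overlap element: waiting in `O` or `On`, being divided, resolved. The field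
  -- `gens` does the same for input elements, where membership in the ideal suffices.
  overlap : ∀ g ∈ s.G, ∀ h ∈ s.G, ∀ x, IsOverlap lt g h x → (∃ q ≤ n₀, HasDegree wt x q) →
    x ∈ s.O ∨ x ∈ s.On ∨
    (∃ p r, s.ctrl = .divOverlap p r ∧ PartiallyResolved wt lt {g | g ∈ s.G} x p r) ∨
    Resolved wt lt {g | g ∈ s.G} x
  gens : ∀ x ∈ F, x ∈ s.W ∨ x ∈ s.Wn ∨
    (∃ p r, s.ctrl = .divGen p r ∧ x - (p + r) ∈ ideal {g | g ∈ s.G}) ∨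
    x ∈ ideal {g | g ∈ s.G}
  division : ∀ p r, s.ctrl = .divOverlap p r ∨ s.ctrl = .divGen p r →
    p + r ∈ ideal F ∧ p ∈ supportedOn K {m | monDeg wt m + 1 = k} ∧
    r ∈ supportedOn K {m | monDeg wt m + 1 = k} ∧ Reduced lt {g | g ∈ s.G} r
  On_empty : s.ctrl = .overlaps ∨ (∃ p r, s.ctrl = .divOverlap p r) ∨ s.On = ∅
  Wn_empty : s.ctrl = .loop ∨ s.ctrl = .halted → s.Wn = ∅
  loop : s.ctrl = .loop → ¬ Finished wt n₀ s
  halted : s.ctrl = .halted → Finished wt n₀ s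

theorem invariant_init (hF : ∃ x ∈ F, ∃ q ≤ n₀, HasDegree wt x q) :
    Invariant wt lt n₀ F 0 (init F) where
  bound_le := Nat.zero_le _
  W_subset := subset_rfl
  W_degree _ _ _ _ := Nat.zero_le _
  Wn_subset := by simp [init]
  Wn_degree := by simp [init]
  O_finite := by simp [init]
  O_ideal := by simp [init]
  O_degree := by simp [init]
  On_finite := by simp [init]
  On_ideal := by simp [init]
  On_degree := by simp [init]
  G_ideal := by simp [init]
  G_degree := by simp [init]
  G_sorted := by simp [init]
  G_incomparable := by simp [init]
  overlap := by simp [init]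
  gens _ hx := Or.inl hx
  division := by simp [init]
  On_empty := by simp [init]
  Wn_empty := by simp [init]
  loop _ := fun h => h.2 hF
  halted := by simp [init]

/-- Overlap elements with a new remainder have a larger degree than the remainder. -/
theorem lt_degree_of_mem_newOverlaps (hwt : ∀ i, 0 < wt i) (hlt : IsMonomialOrder lt)
    {L : List (FreeAlg K N)} {r x : FreeAlg K N} {d q : ℕ} (hr : HasDegree wt r d)
    (hL : ∀ g ∈ L, ∃ q ≤ d, HasDegree wt g q)
    (hgr : ∀ g ∈ L, ¬ Divides (LM lt g) (LM lt r))
    (hx : x ∈ newOverlaps wt lt n₀ L r) (hq : HasDegree wt x q) : d < q := by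
  have deg : ∀ {f g : FreeAlg K N} {i j : ℕ} {u v : Mon N}, HasDegree wt f i → HasDegree wt g j →
      LM lt f * u = v * LM lt g →
      x = (LC lt f)⁻¹ • (f * mon K u) - (LC lt g)⁻¹ • (mon K v * g) →
      q = i + monDeg wt u ∧ q = monDeg wt v + j := by
    intro f g i j u v hf hg h hx
    have h₁ := mem_supportedOn.1 (overlap_mem_lower hlt hf hg h) (LM lt x)
      (hx ▸ (hlt.isLeadingMonomial_LM hq.1).1)
    have h₂ := h₁.2
    rw [hlt.monDeg_LM hq] at h₂
    refine ⟨?_, ?_⟩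
    · rw [h₂, monDeg_mul, hlt.monDeg_LM hf]
    · rw [h₂, h, monDeg_mul, hlt.monDeg_LM hg]
  obtain ⟨⟨g, hg, ⟨-, -, u, v, h, hv, hu, hx⟩ | ⟨-, -, u, v, h, hv, hu, hx⟩⟩ |
    ⟨-, -, u, v, h, hv, hu, hx⟩, -⟩ := hx
  · obtain ⟨e, -, he⟩ := hL g hg
    have h₁ := (deg he hr h hx).2
    -- The degree of `x` is that of `r` plus that of `v`, so the strict inequality amounts to `v ≠
    -- 1`.
    have : v ≠ 1 := by
      rintro rfl
      exact hgr g hg ⟨1, u, by rw [one_mul, h, one_mul]⟩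
    have := monDeg_pos hwt this
    omega
  · obtain ⟨e, -, he⟩ := hL g hg
    have h₁ := (deg hr he h hx).1
    have : u ≠ 1 := by
      rintro rfl
      exact hgr g hg ⟨v, 1, by rw [mul_one, ← h, mul_one]⟩
    have := monDeg_pos hwt this
    omega
  · have h₁ := (deg hr hr h hx).1
    -- A self-overlap with `u = 1` is the trivial one; it gives the element zero, which has no
    -- degree.
    have : u ≠ 1 := by
      rintro rfl
      have hv1 : v = 1 := by
        have := congrArg FreeMonoid.length h
        simp only [FreeMonoid.length_mul, FreeMonoid.length_one] at this
        exact FreeMonoid.length_eq_zero.1 (by omega)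
      subst hv1
      exact hq.1 (by simp [hx, mon_one])
    have := monDeg_pos hwt this
    omega

/-- A monomial dividing another one of at most its degree is equal to it. -/
theorem Divides.eq_of_monDeg_le (hwt : ∀ i, 0 < wt i) {u v : Mon N} (h : Divides u v)
    (hd : monDeg wt v ≤ monDeg wt u) : u = v := by
  obtain ⟨a, b, rfl⟩ := h
  simp only [monDeg_mul] at hd
  have ha : a = 1 := by
    by_contra ha
    have := monDeg_pos hwt ha
    omega
  have hb : b = 1 := by
    by_contra hb
    have := monDeg_pos hwt hb
    omega
  simp [ha, hb]

namespace Invariant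

variable {k : ℕ} {s : State K N}

/-- A zero remainder means that the divided element is settled. A nonzero one has degree `k - 1`,
the largest in `𝒢`, and is reduced modulo `𝒢`: order and incomparability survive, and its new
overlaps have degree at least `k`, so they belong in `O` and not in `On`. -/
theorem record (hwt : ∀ i, 0 < wt i) (hlt : IsMonomialOrder lt)
    (hs : Invariant wt lt n₀ F k s) {r : FreeAlg K N} {c : Ctrl K N}
    (hc : s.ctrl = .divOverlap 0 r ∧ c = .overlaps ∨ s.ctrl = .divGen 0 r ∧ c = .gens) :
    Invariant wt lt n₀ F k { record wt lt n₀ s r with ctrl := c } := by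
  obtain ⟨hI, -, hrk, hred⟩ := hs.division 0 r (hc.imp And.left And.left)
  rw [zero_add] at hI
  have hcl : c ≠ .loop ∧ c ≠ .halted ∧ (∀ p r, c ≠ .divOverlap p r) ∧ ∀ p r, c ≠ .divGen p r := by
    rcases hc with ⟨-, rfl⟩ | ⟨-, rfl⟩ <;> simp
  have hOn : c = .overlaps ∨ (∃ p r, c = .divOverlap p r) ∨ s.On = ∅ := by
    rcases hc with ⟨-, rfl⟩ | ⟨hc, -⟩
    · exact Or.inl rfl
    · exact Or.inr (Or.inr (by simpa [hc] using hs.On_empty))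
  by_cases hr0 : r = 0
  · subst hr0
    rw [FreeGB.record, if_pos rfl]
    refine { hs with
      overlap := fun g hg h hh x hx hq => ?_, gens := fun x hx => ?_, division := ?_,
      On_empty := hOn, Wn_empty := ?_, loop := ?_, halted := ?_ }
    · rcases hs.overlap g hg h hh x hx hq with h | h | ⟨p, r, h, hp⟩ | h
      · exact Or.inl h
      · exact Or.inr (Or.inl h)
      · rcases hc with ⟨hc, -⟩ | ⟨hc, -⟩ <;> rw [hc] at h
        · cases h
          exact Or.inr (Or.inr (Or.inr hp.resolved_of_zero))
        · cases h
      · exact Or.inr (Or.inr (Or.inr h))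
    · rcases hs.gens x hx with h | h | ⟨p, r, h, hp⟩ | h
      · exact Or.inl h
      · exact Or.inr (Or.inl h)
      · rcases hc with ⟨hc, -⟩ | ⟨hc, -⟩ <;> rw [hc] at h
        · cases h
        · cases h
          exact Or.inr (Or.inr (Or.inr (by simpa using hp)))
      · exact Or.inr (Or.inr (Or.inr h))
    · rintro p r (h | h)
      · exact absurd h (hcl.2.2.1 p r)
      · exact absurd h (hcl.2.2.2 p r)
    · rintro (h | h)
      · exact absurd h hcl.1
      · exact absurd h hcl.2.1
    · exact fun h => absurd h hcl.1
    · exact fun h => absurd h hcl.2.1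
  · obtain ⟨d, rfl⟩ : ∃ d, k = d + 1 :=
      ⟨_, (mem_supportedOn.1 hrk _ (hlt.isLeadingMonomial_LM hr0).1).symm⟩
    have hrd : HasDegree wt r d :=
      ⟨hr0, fun m hm => Nat.succ_injective (mem_supportedOn.1 hrk m hm)⟩
    have hGd : ∀ g ∈ s.G, ∃ q ≤ d, HasDegree wt g q := fun g hg => by
      obtain ⟨q, hq, h⟩ := hs.G_degree g hg
      exact ⟨q, Nat.lt_succ_iff.1 hq, h⟩
    have hgr : ∀ g ∈ s.G, ¬ Divides (LM lt g) (LM lt r) :=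
      hred _ (hlt.isLeadingMonomial_LM hr0).1
    have hle : ∀ g ∈ s.G, monDeg wt (LM lt g) ≤ monDeg wt (LM lt r) := fun g hg => by
      obtain ⟨q, hq, h⟩ := hGd g hg
      rwa [hlt.monDeg_LM h, hlt.monDeg_LM hrd]
    -- As `r` has maximal degree, `LM r` could divide `LM g` only by being equal to it, and then `LM
    -- g` would divide `LM r`.
    have hrg : ∀ g ∈ s.G, ¬ Divides (LM lt r) (LM lt g) := fun g hg h =>
      hgr g hg ((h.eq_of_monDeg_le hwt (hle g hg)) ▸ divides_refl _)
    have hsub : {g | g ∈ s.G} ⊆ {g | g ∈ s.G ++ [r]} := fun g hg => List.mem_append_left _ hg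
    have hr : r ∈ {g | g ∈ s.G ++ [r]} := by simp
    have hcase : ∀ {g}, g ∈ s.G ++ [r] → g ∈ s.G ∨ g = r := by simp
    rw [FreeGB.record, if_neg hr0]
    refine { hs with
      O_finite := hs.O_finite.union (newOverlaps_finite _ _ _), O_ideal := ?_, O_degree := ?_,
      G_ideal := ?_, G_degree := ?_, G_sorted := ?_, G_incomparable := ?_,
      overlap := fun g hg h hh x hx hq => ?_, gens := fun x hx => ?_, division := ?_,
      On_empty := hOn, Wn_empty := ?_, loop := ?_, halted := ?_ }
    · rintro x (hx | ⟨⟨g, hg, hx | hx⟩ | hx, -⟩)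
      · exact hs.O_ideal x hx
      · exact hx.mem_ideal (hs.G_ideal g hg) hI
      · exact hx.mem_ideal hI (hs.G_ideal g hg)
      · exact hx.mem_ideal hI hI
    · rintro x (hx | hx)
      · exact hs.O_degree x hx
      · obtain ⟨q, hq, hxq⟩ := hx.2
        exact ⟨q, lt_degree_of_mem_newOverlaps hwt hlt hrd hGd hgr hx hxq, hq, hxq⟩
    · intro g hg
      rcases hcase hg with hg | rfl
      · exact hs.G_ideal g hg
      · exact hI
    · intro g hg
      rcases hcase hg with hg | rfl
      · exact hs.G_degree g hg
      · exact ⟨d, Nat.lt_succ_self d, hrd⟩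
    · exact List.pairwise_append.2 ⟨hs.G_sorted, List.pairwise_singleton _ _, by simpa using hle⟩
    · intro g hg h hh hgh
      rcases hcase hg with hg' | rfl <;> rcases hcase hh with hh' | rfl
      · exact hs.G_incomparable g hg' h hh' hgh
      · exact absurd hgh (hgr g hg')
      · exact absurd hgh (hrg h hh')
      · rfl
    · rcases hcase hg with hg' | rfl <;> rcases hcase hh with hh' | rfl
      · rcases hs.overlap g hg' h hh' x hx hq with h | h | ⟨p, r', h, hp⟩ | h
        · exact Or.inl (Or.inl h)
        · exact Or.inr (Or.inl h)
        · rcases hc with ⟨hc, -⟩ | ⟨hc, -⟩ <;> rw [hc] at h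
          · cases h
            exact Or.inr (Or.inr (Or.inr (hp.resolved hlt hsub hr hr0)))
          · cases h
        · exact Or.inr (Or.inr (Or.inr (h.mono hsub)))
      · exact Or.inl (Or.inr ⟨Or.inl ⟨g, hg', Or.inl hx⟩, hq⟩)
      · exact Or.inl (Or.inr ⟨Or.inl ⟨h, hh', Or.inr hx⟩, hq⟩)
      · exact Or.inl (Or.inr ⟨Or.inr hx, hq⟩)
    · have hle := TwoSidedIdeal.span_mono hsub
      rcases hs.gens x hx with h | h | ⟨p, r', h, hp⟩ | h
      · exact Or.inl h
      · exact Or.inr (Or.inl h)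
      · rcases hc with ⟨hc, -⟩ | ⟨hc, -⟩ <;> rw [hc] at h
        · cases h
        · cases h
          rw [zero_add] at hp
          have := add_mem (hle hp) (TwoSidedIdeal.subset_span hr)
          exact Or.inr (Or.inr (Or.inr (by simpa using this)))
      · exact Or.inr (Or.inr (Or.inr (hle h)))
    · rintro p r (h | h)
      · exact absurd h (hcl.2.2.1 p r)
      · exact absurd h (hcl.2.2.2 p r)
    · rintro (h | h)
      · exact absurd h hcl.1
      · exact absurd h hcl.2.1
    · exact fun h => absurd h hcl.1
    · exact fun h => absurd h hcl.2.1

end Invariant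

end FreeGB

namespace FreeGB

variable {K : Type*} [Field K] {N : ℕ} {wt : Fin N → ℕ} {lt : Mon N → Mon N → Prop}
  {n₀ : ℕ} {F : Set (FreeAlg K N)}

/-! ### Termination -/

/-- Which of the WHILE loops of the current round are still to be completed. -/
def Ctrl.phase : Ctrl K N → ℕ
  | .overlaps | .divOverlap _ _ => 2
  | .gens | .divGen _ _ => 1
  | .loop | .halted => 0

/-- How far the current division is from its end. -/
noncomputable def Ctrl.rank (hlt : IsMonomialOrder lt) : Ctrl K N → Ordinal.{0}
  -- The successor puts even a completed division, `p = 0`, above the loop test, so that recording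
  -- the remainder lowers the rank.
  | .divOverlap p _ | .divGen p _ => Order.succ (divRank hlt p)
  | _ => 0

/-- The termination measure of the algorithm. -/
noncomputable def State.measure (hlt : IsMonomialOrder lt) (n₀ k : ℕ) (s : State K N) :
    ℕ ×ₗ ℕ ×ₗ ℕ ×ₗ Ordinal.{0} :=
  -- Each kind of step may raise only coordinates after the one it lowers: a new round refills the
  -- work lists but raises `k`, a choice starts a division but shortens a list. The growing sets `O`
  -- and `G` do not enter.
  toLex (n₀ + 1 - k, toLex (s.ctrl.phase, toLex (s.On.ncard + s.Wn.ncard, s.ctrl.rank hlt)))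

namespace State

variable {hlt : IsMonomialOrder lt} {k k' : ℕ} {s s' : State K N}

theorem measure_lt_of_bound (h : n₀ + 1 - k' < n₀ + 1 - k) :
    s'.measure hlt n₀ k' < s.measure hlt n₀ k :=
  Prod.Lex.toLex_lt_toLex.2 (Or.inl h)

theorem measure_lt_of_phase (h : s'.ctrl.phase < s.ctrl.phase) :
    s'.measure hlt n₀ k < s.measure hlt n₀ k :=
  Prod.Lex.toLex_lt_toLex.2 (Or.inr ⟨rfl, Prod.Lex.toLex_lt_toLex.2 (Or.inl h)⟩)

theorem measure_lt_of_ncard (h : s'.ctrl.phase = s.ctrl.phase)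
    (h' : s'.On.ncard + s'.Wn.ncard < s.On.ncard + s.Wn.ncard) :
    s'.measure hlt n₀ k < s.measure hlt n₀ k :=
  Prod.Lex.toLex_lt_toLex.2 (Or.inr ⟨rfl, Prod.Lex.toLex_lt_toLex.2 (Or.inr
    ⟨h, Prod.Lex.toLex_lt_toLex.2 (Or.inl h')⟩)⟩)

theorem measure_lt_of_rank (h : s'.ctrl.phase = s.ctrl.phase) (hO : s'.On = s.On)
    (hW : s'.Wn = s.Wn) (h' : s'.ctrl.rank hlt < s.ctrl.rank hlt) :
    s'.measure hlt n₀ k < s.measure hlt n₀ k :=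
  Prod.Lex.toLex_lt_toLex.2 (Or.inr ⟨rfl, Prod.Lex.toLex_lt_toLex.2 (Or.inr
    ⟨h, Prod.Lex.toLex_lt_toLex.2 (Or.inr ⟨by rw [hO, hW], h'⟩)⟩)⟩)

end State

theorem record_On (s : State K N) (r : FreeAlg K N) : (record wt lt n₀ s r).On = s.On := by
  unfold record
  split_ifs <;> rfl

theorem record_Wn (s : State K N) (r : FreeAlg K N) : (record wt lt n₀ s r).Wn = s.Wn := by
  unfold record
  split_ifs <;> rfl

/-! ### Preservation of the invariant and decrease of the measure -/

namespace Invariant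

variable {k : ℕ} {s : State K N}

theorem G_homogeneous (hs : Invariant wt lt n₀ F k s) : ∀ g ∈ s.G, ∃ q, HasDegree wt g q :=
  fun g hg => (hs.G_degree g hg).imp fun _ h => h.2

theorem bound_le_degree (hs : Invariant wt lt n₀ F k s) {x : FreeAlg K N} {q : ℕ}
    (hx : x ∈ s.W ∪ s.O) (hq : HasDegree wt x q) : k ≤ q := by
  rcases hx with hx | hx
  · exact hs.W_degree x hx q hq
  · obtain ⟨q', hk, -, h⟩ := hs.O_degree x hx
    rwa [hq.unique h]

theorem exists_degree_le (hs : Invariant wt lt n₀ F k s) (h : ¬ Finished wt n₀ s) :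
    ∃ q ≤ n₀, ∃ x ∈ s.W ∪ s.O, HasDegree wt x q := by
  by_cases hO : s.O = ∅
  · have : ∃ f ∈ s.W, ∃ q ≤ n₀, HasDegree wt f q := by
      by_contra h'
      exact h ⟨hO, h'⟩
    obtain ⟨x, hx, q, hq, hxq⟩ := this
    exact ⟨q, hq, x, Or.inl hx, hxq⟩
  · obtain ⟨x, hx⟩ := Set.nonempty_iff_ne_empty.2 hO
    obtain ⟨q, -, hq, hxq⟩ := hs.O_degree x hx
    exact ⟨q, hq, x, Or.inr hx, hxq⟩

/-- At the head of the loop some element of degree at most `n₀` is waiting, so the least degree `n`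
is at most `n₀` even if `W` also contains larger degrees. Since `k ≤ n`, the new bound `n + 1` is a
strict increase. -/
theorem enter (hs : Invariant wt lt n₀ F k s) {n : ℕ} (hc : s.ctrl = .loop)
    (hn : IsLeast {q | ∃ x ∈ s.W ∪ s.O, HasDegree wt x q} n) :
    k ≤ n ∧ n ≤ n₀ ∧ Invariant wt lt n₀ F (n + 1)
      { s with
        ctrl := .overlaps
        On := {h | h ∈ s.O ∧ HasDegree wt h n}
        Wn := {f | f ∈ s.W ∧ HasDegree wt f n}
        O := s.O \ {h | h ∈ s.O ∧ HasDegree wt h n}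
        W := s.W \ {f | f ∈ s.W ∧ HasDegree wt f n} } := by
  have hn₀ : n ≤ n₀ := by
    obtain ⟨q, hq, hx⟩ := hs.exists_degree_le (hs.loop hc)
    exact (hn.2 hx).trans hq
  have hkn : k ≤ n := by
    obtain ⟨x, hx, hxn⟩ := hn.1
    exact hs.bound_le_degree hx hxn
  have hOn : s.On = ∅ := by simpa [hc] using hs.On_empty
  have hWn : s.Wn = ∅ := hs.Wn_empty (Or.inl hc)
  refine ⟨hkn, hn₀, { hs with
    bound_le := Nat.succ_le_succ hn₀
    W_subset := fun x hx => hs.W_subset hx.1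
    W_degree := fun x hx q hq => ?_
    Wn_subset := fun x hx => hs.W_subset hx.1
    Wn_degree := fun x hx => ⟨n, rfl, hx.2⟩
    O_finite := hs.O_finite.subset Set.sdiff_subset
    O_ideal := fun x hx => hs.O_ideal x hx.1
    O_degree := fun x hx => ?_
    On_finite := hs.O_finite.subset fun x hx => hx.1
    On_ideal := fun x hx => hs.O_ideal x hx.1
    On_degree := fun x hx => ⟨n, rfl, hx.2⟩
    G_degree := fun g hg => ?_
    overlap := fun g hg h hh x hx hq => ?_
    gens := fun x hx => ?_
    division := by simp
    On_empty := Or.inl rfl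
    Wn_empty := by simp
    loop := by simp
    halted := by simp }⟩
  · refine lt_of_le_of_ne (hn.2 ⟨x, Or.inl hx.1, hq⟩) ?_
    rintro rfl
    exact hx.2 ⟨hx.1, hq⟩
  · obtain ⟨q, -, hq, hxq⟩ := hs.O_degree x hx.1
    refine ⟨q, lt_of_le_of_ne (hn.2 ⟨x, Or.inr hx.1, hxq⟩) ?_, hq, hxq⟩
    rintro rfl
    exact hx.2 ⟨hx.1, hxq⟩
  · obtain ⟨q, hq, hgq⟩ := hs.G_degree g hg
    exact ⟨q, by omega, hgq⟩
  · rcases hs.overlap g hg h hh x hx hq with h | h | ⟨p, r, h, -⟩ | h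
    · by_cases hxn : HasDegree wt x n
      · exact Or.inr (Or.inl ⟨h, hxn⟩)
      · exact Or.inl ⟨h, fun h' => hxn h'.2⟩
    · simp [hOn] at h
    · simp [hc] at h
    · exact Or.inr (Or.inr (Or.inr h))
  · rcases hs.gens x hx with h | h | ⟨p, r, h, -⟩ | h
    · by_cases hxn : HasDegree wt x n
      · exact Or.inr (Or.inl ⟨h, hxn⟩)
      · exact Or.inl ⟨h, fun h' => hxn h'.2⟩
    · simp [hWn] at h
    · simp [hc] at h
    · exact Or.inr (Or.inr (Or.inr h))

theorem mem_supportedOn_of_hasDegree {x : FreeAlg K N} {q : ℕ} (hqk : q + 1 = k)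
    (hx : HasDegree wt x q) : x ∈ supportedOn K {m | monDeg wt m + 1 = k} :=
  mem_supportedOn.2 fun m hm => by
    rw [Set.mem_ofPred_eq, hx.2 m hm, hqk]

theorem chooseOverlap (hs : Invariant wt lt n₀ F k s) {h : FreeAlg K N}
    (hc : s.ctrl = .overlaps) (hh : h ∈ s.On) :
    Invariant wt lt n₀ F k { s with ctrl := .divOverlap h 0, On := s.On \ {h} } := by
  obtain ⟨q, hqk, hq⟩ := hs.On_degree h hh
  refine { hs with
    On_finite := hs.On_finite.subset Set.sdiff_subset
    On_ideal := fun x hx => hs.On_ideal x hx.1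
    On_degree := fun x hx => hs.On_degree x hx.1
    overlap := fun g hg g' hg' x hx hxq => ?_
    gens := fun x hx => ?_
    division := ?_
    On_empty := Or.inr (Or.inl ⟨_, _, rfl⟩)
    Wn_empty := by simp
    loop := by simp
    halted := by simp }
  · rcases hs.overlap g hg g' hg' x hx hxq with h' | h' | ⟨p, r, h', -⟩ | h'
    · exact Or.inl h'
    · by_cases hxh : x = h
      · subst hxh
        exact Or.inr (Or.inr (Or.inl ⟨x, 0, rfl, partiallyResolved_self x⟩))
      · exact Or.inr (Or.inl ⟨h', hxh⟩)
    · simp [hc] at h'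
    · exact Or.inr (Or.inr (Or.inr h'))
  · rcases hs.gens x hx with h' | h' | ⟨p, r, h', -⟩ | h'
    · exact Or.inl h'
    · exact Or.inr (Or.inl h')
    · simp [hc] at h'
    · exact Or.inr (Or.inr (Or.inr h'))
  · rintro p r (h' | h') <;> cases h'
    exact ⟨by simpa using hs.On_ideal h hh, mem_supportedOn_of_hasDegree hqk hq, zero_mem _,
      by simp [Reduced]⟩

theorem chooseGen (hs : Invariant wt lt n₀ F k s) {f : FreeAlg K N}
    (hc : s.ctrl = .gens) (hf : f ∈ s.Wn) :
    Invariant wt lt n₀ F k { s with ctrl := .divGen f 0, Wn := s.Wn \ {f} } := by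
  obtain ⟨q, hqk, hq⟩ := hs.Wn_degree f hf
  refine { hs with
    Wn_subset := Set.sdiff_subset.trans hs.Wn_subset
    Wn_degree := fun x hx => hs.Wn_degree x hx.1
    overlap := fun g hg g' hg' x hx hxq => ?_
    gens := fun x hx => ?_
    division := ?_
    On_empty := by simpa [hc] using hs.On_empty
    Wn_empty := by simp
    loop := by simp
    halted := by simp }
  · rcases hs.overlap g hg g' hg' x hx hxq with h' | h' | ⟨p, r, h', -⟩ | h'
    · exact Or.inl h'
    · exact Or.inr (Or.inl h')
    · simp [hc] at h'
    · exact Or.inr (Or.inr (Or.inr h'))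
  · rcases hs.gens x hx with h' | h' | ⟨p, r, h', -⟩ | h'
    · exact Or.inl h'
    · by_cases hxf : x = f
      · subst hxf
        exact Or.inr (Or.inr (Or.inl ⟨x, 0, rfl, by simp [zero_mem]⟩))
      · exact Or.inr (Or.inl ⟨h', hxf⟩)
    · simp [hc] at h'
    · exact Or.inr (Or.inr (Or.inr h'))
  · rintro p r (h' | h') <;> cases h'
    exact ⟨by simpa using TwoSidedIdeal.subset_span (hs.Wn_subset hf),
      mem_supportedOn_of_hasDegree hqk hq, zero_mem _, by simp [Reduced]⟩

/-- What a step of a division needs and preserves, regardless of what is being divided. -/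
theorem division_step (hlt : IsMonomialOrder lt) (hs : Invariant wt lt n₀ F k s)
    {p r p' r' : FreeAlg K N} (hc : s.ctrl = .divOverlap p r ∨ s.ctrl = .divGen p r)
    (hd : DivStep lt s.G (p, r) (p', r')) :
    (p' + r' ∈ ideal F ∧ p' ∈ supportedOn K {m | monDeg wt m + 1 = k} ∧
      r' ∈ supportedOn K {m | monDeg wt m + 1 = k} ∧ Reduced lt {g | g ∈ s.G} r') ∧
    p' ∈ supportedOn K (lower wt lt (LM lt p)) := by
  obtain ⟨hI, hp, hr, hred⟩ := hs.division p r hc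
  have hLM := mem_supportedOn.1 hp _ (hlt.isLeadingMonomial_LM hd.ne_zero).1
  have hpq : HasDegree wt p (monDeg wt (LM lt p)) :=
    ⟨hd.ne_zero, fun m hm => Nat.succ_injective ((mem_supportedOn.1 hp m hm).trans hLM.symm)⟩
  have hlow := hd.mem_lower hlt hs.G_homogeneous hpq
  have hle : ideal {g | g ∈ s.G} ≤ ideal F := TwoSidedIdeal.span_le.2 hs.G_ideal
  refine ⟨⟨?_, supportedOn_mono (fun m hm => ?_) hlow, hd.remainder_mem hlt hp hr,
    hd.reduced hred⟩, hlow⟩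
  · have := sub_mem hI (hle hd.mem_ideal)
    rwa [sub_sub_cancel] at this
  · rw [Set.mem_ofPred_eq, hm.2]
    exact hLM

theorem divideOverlap (hlt : IsMonomialOrder lt) (hs : Invariant wt lt n₀ F k s)
    {p r p' r' : FreeAlg K N} (hc : s.ctrl = .divOverlap p r)
    (hd : DivStep lt s.G (p, r) (p', r')) :
    Invariant wt lt n₀ F k { s with ctrl := .divOverlap p' r' } := by
  refine { hs with
    overlap := fun g hg g' hg' x hx hxq => ?_
    gens := fun x hx => ?_
    division := ?_
    On_empty := Or.inr (Or.inl ⟨_, _, rfl⟩)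
    Wn_empty := by simp
    loop := by simp
    halted := by simp }
  · rcases hs.overlap g hg g' hg' x hx hxq with h' | h' | ⟨q, t, h', h''⟩ | h'
    · exact Or.inl h'
    · exact Or.inr (Or.inl h')
    · rw [hc] at h'
      cases h'
      exact Or.inr (Or.inr (Or.inl ⟨p', r', rfl, hd.partiallyResolved hlt hs.G_homogeneous h''⟩))
    · exact Or.inr (Or.inr (Or.inr h'))
  · rcases hs.gens x hx with h' | h' | ⟨q, t, h', -⟩ | h'
    · exact Or.inl h'
    · exact Or.inr (Or.inl h')
    · simp [hc] at h'
    · exact Or.inr (Or.inr (Or.inr h'))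
  · rintro q t (h' | h') <;> cases h'
    exact (hs.division_step hlt (Or.inl hc) hd).1

theorem divideGen (hlt : IsMonomialOrder lt) (hs : Invariant wt lt n₀ F k s)
    {p r p' r' : FreeAlg K N} (hc : s.ctrl = .divGen p r)
    (hd : DivStep lt s.G (p, r) (p', r')) :
    Invariant wt lt n₀ F k { s with ctrl := .divGen p' r' } := by
  refine { hs with
    overlap := fun g hg g' hg' x hx hxq => ?_
    gens := fun x hx => ?_
    division := ?_
    On_empty := by simpa [hc] using hs.On_empty
    Wn_empty := by simp
    loop := by simp
    halted := by simp }
  · rcases hs.overlap g hg g' hg' x hx hxq with h' | h' | ⟨q, t, h', -⟩ | h'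
    · exact Or.inl h'
    · exact Or.inr (Or.inl h')
    · simp [hc] at h'
    · exact Or.inr (Or.inr (Or.inr h'))
  · rcases hs.gens x hx with h' | h' | ⟨q, t, h', h''⟩ | h'
    · exact Or.inl h'
    · exact Or.inr (Or.inl h')
    · rw [hc] at h'
      cases h'
      have := add_mem h'' hd.mem_ideal
      rw [sub_add_sub_cancel] at this
      exact Or.inr (Or.inr (Or.inl ⟨p', r', rfl, this⟩))
    · exact Or.inr (Or.inr (Or.inr h'))
  · rintro q t (h' | h') <;> cases h'
    exact (hs.division_step hlt (Or.inr hc) hd).1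

/-- Moving on from the test of a WHILE loop, nothing else being changed. -/
theorem moveOn (hs : Invariant wt lt n₀ F k s) {c : Ctrl K N}
    (hc : s.ctrl = .overlaps ∨ s.ctrl = .gens) (hcO : ∀ p r, c ≠ .divOverlap p r)
    (hcG : ∀ p r, c ≠ .divGen p r) (hOn : s.On = ∅)
    (hWn : c = .loop ∨ c = .halted → s.Wn = ∅) (hl : c = .loop → ¬ Finished wt n₀ s)
    (hh : c = .halted → Finished wt n₀ s) : Invariant wt lt n₀ F k { s with ctrl := c } := by
  refine { hs with
    overlap := fun g hg g' hg' x hx hxq => ?_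
    gens := fun x hx => ?_
    division := ?_
    On_empty := Or.inr (Or.inr hOn)
    Wn_empty := hWn
    loop := hl
    halted := hh }
  · rcases hs.overlap g hg g' hg' x hx hxq with h' | h' | ⟨q, t, h', -⟩ | h'
    · exact Or.inl h'
    · exact Or.inr (Or.inl h')
    · simp [h'] at hc
    · exact Or.inr (Or.inr (Or.inr h'))
  · rcases hs.gens x hx with h' | h' | ⟨q, t, h', -⟩ | h'
    · exact Or.inl h'
    · exact Or.inr (Or.inl h')
    · simp [h'] at hc
    · exact Or.inr (Or.inr (Or.inr h'))
  · rintro q t (h' | h')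
    · exact absurd h' (hcO q t)
    · exact absurd h' (hcG q t)

theorem step (hwt : ∀ i, 0 < wt i) (hlt : IsMonomialOrder lt) (hF : F.Finite)
    (hs : Invariant wt lt n₀ F k s) {s' : State K N} (h : Step wt lt n₀ s s') :
    ∃ k', Invariant wt lt n₀ F k' s' ∧ s'.measure hlt n₀ k' < s.measure hlt n₀ k := by
  cases h with
  | enter n hc hn =>
    obtain ⟨hkn, hn₀, h⟩ := hs.enter hc hn
    exact ⟨n + 1, h, State.measure_lt_of_bound (by omega)⟩
  | chooseOverlap h hc hh =>
    refine ⟨k, hs.chooseOverlap hc hh, State.measure_lt_of_ncard (by rw [hc]; rfl) ?_⟩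
    exact Nat.add_lt_add_right (Set.ncard_sdiff_singleton_lt_of_mem hh hs.On_finite) _
  | divideOverlap p r p' r' hc hd =>
    refine ⟨k, hs.divideOverlap hlt hc hd, State.measure_lt_of_rank (by rw [hc]; rfl) rfl rfl ?_⟩
    rw [hc]
    exact Order.succ_lt_succ (divRank_lt hlt hd.ne_zero (hs.division_step hlt (Or.inl hc) hd).2)
  | recordOverlap r hc =>
    refine ⟨k, hs.record hwt hlt (Or.inl ⟨hc, rfl⟩), State.measure_lt_of_rank (by rw [hc]; rfl)
      (record_On s r) (record_Wn s r) ?_⟩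
    rw [hc]
    exact Order.bot_lt_succ _
  | endOverlaps hc hO =>
    refine ⟨k, hs.moveOn (Or.inl hc) (by simp) (by simp) hO (by simp) (by simp) (by simp),
      State.measure_lt_of_phase ?_⟩
    rw [hc]
    exact Nat.lt_succ_self 1
  | chooseGen f hc hf =>
    refine ⟨k, hs.chooseGen hc hf, State.measure_lt_of_ncard (by rw [hc]; rfl) ?_⟩
    exact Nat.add_lt_add_left (Set.ncard_sdiff_singleton_lt_of_mem hf (hF.subset hs.Wn_subset)) _
  | divideGen p r p' r' hc hd =>
    refine ⟨k, hs.divideGen hlt hc hd, State.measure_lt_of_rank (by rw [hc]; rfl) rfl rfl ?_⟩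
    rw [hc]
    exact Order.succ_lt_succ (divRank_lt hlt hd.ne_zero (hs.division_step hlt (Or.inr hc) hd).2)
  | recordGen r hc =>
    refine ⟨k, hs.record hwt hlt (Or.inr ⟨hc, rfl⟩), State.measure_lt_of_rank (by rw [hc]; rfl)
      (record_On s r) (record_Wn s r) ?_⟩
    rw [hc]
    exact Order.bot_lt_succ _
  | again hc hW hu =>
    refine ⟨k, hs.moveOn (Or.inr hc) (by simp) (by simp) (by simpa [hc] using hs.On_empty)
      (fun _ => hW) (fun _ => hu) (by simp), State.measure_lt_of_phase ?_⟩
    rw [hc]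
    exact Nat.lt_succ_self 0
  | halt hc hW hu =>
    refine ⟨k, hs.moveOn (Or.inr hc) (by simp) (by simp) (by simpa [hc] using hs.On_empty)
      (fun _ => hW) (by simp) (fun _ => hu), State.measure_lt_of_phase ?_⟩
    rw [hc]
    exact Nat.lt_succ_self 0

/-- The algorithm can be carried on until it stops. -/
theorem exists_step (hs : Invariant wt lt n₀ F k s) (hc : s.ctrl ≠ .halted) :
    ∃ s', Step wt lt n₀ s s' := by
  cases h : s.ctrl with
  | loop =>
    obtain ⟨q, -, hx⟩ := hs.exists_degree_le (hs.loop h)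
    classical
    have hex : ∃ q, ∃ x ∈ s.W ∪ s.O, HasDegree wt x q := ⟨q, hx⟩
    exact ⟨_, .enter s (Nat.find hex) h ⟨Nat.find_spec hex, fun _ hm => Nat.find_min' hex hm⟩⟩
  | overlaps =>
    rcases s.On.eq_empty_or_nonempty with hO | ⟨x, hx⟩
    · exact ⟨_, .endOverlaps s h hO⟩
    · exact ⟨_, .chooseOverlap s x h hx⟩
  | divOverlap p r =>
    by_cases hp : p = 0
    · subst hp
      exact ⟨_, .recordOverlap s r h⟩
    · obtain ⟨p', r', hd⟩ := DivStep.exists_step (lt := lt) (L := s.G) r hp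
      exact ⟨_, .divideOverlap s p r p' r' h hd⟩
  | gens =>
    rcases s.Wn.eq_empty_or_nonempty with hW | ⟨x, hx⟩
    · by_cases hu : Finished wt n₀ s
      · exact ⟨_, .halt s h hW hu⟩
      · exact ⟨_, .again s h hW hu⟩
    · exact ⟨_, .chooseGen s x h hx⟩
  | divGen p r =>
    by_cases hp : p = 0
    · subst hp
      exact ⟨_, .recordGen s r h⟩
    · obtain ⟨p', r', hd⟩ := DivStep.exists_step (lt := lt) (L := s.G) r hp
      exact ⟨_, .divideGen s p r p' r' h hd⟩
  | halted => exact absurd h hc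

/-! ### The result -/

/-- At the end nothing is waiting or being divided, so every nonzero overlap element of degree at
most `n₀` is resolved. The bound to use is the overlap word `LM g * u`, below which its monomials
lie. -/
theorem confluent (hlt : IsMonomialOrder lt) (hs : Invariant wt lt n₀ F k s)
    (hc : s.ctrl = .halted) : Confluent wt lt n₀ {g | g ∈ s.G} where
  homogeneous := hs.G_homogeneous
  incomparable := hs.G_incomparable
  overlap g hg h hh u v huv hv hu hn := by
    obtain ⟨i, hi⟩ := hs.G_homogeneous g hg
    obtain ⟨j, hj⟩ := hs.G_homogeneous h hh
    have hlow := overlap_mem_lower hlt hi hj huv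
    -- Zero overlap elements are never put in `O`, so the invariant does not speak of them.
    by_cases h0 : (LC lt g)⁻¹ • (g * mon K u) - (LC lt h)⁻¹ • (mon K v * h) = 0
    · rw [h0]
      exact zero_mem _
    · rcases hs.overlap g hg h hh _ ⟨hi.1, hj.1, u, v, huv, hv, hu, rfl⟩
        ⟨_, hn, h0, fun m hm => (mem_supportedOn.1 hlow m hm).2⟩ with h' | h' | ⟨_, _, h', -⟩ | h'
      · simp [(hs.halted hc).1] at h'
      · have : s.On = ∅ := by simpa [hc] using hs.On_empty
        simp [this] at h'
      · simp [hc] at h'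
      · exact h' _ hlow

/-- The finite generating set required by the definition is `𝒢` together with the leftover `W`.
Truncation at `n₀` removes exactly `W`. -/
theorem isTruncatedGB (hlt : IsMonomialOrder lt) (hF : F.Finite)
    (hFh : ∀ x ∈ F, ∃ q, HasDegree wt x q) (hs : Invariant wt lt n₀ F k s)
    (hc : s.ctrl = .halted) : IsTruncatedGB wt lt n₀ (ideal F) {g | g ∈ s.G} := by
  have hfin := (hs.halted hc).2
  have hhom : ∀ g ∈ {g | g ∈ s.G} ∪ s.W, ∃ q, HasDegree wt g q := by
    rintro g (hg | hg)
    · exact hs.G_homogeneous g hg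
    · exact hFh g (hs.W_subset hg)
  have hideal : ideal F = ideal ({g | g ∈ s.G} ∪ s.W) := by
    apply le_antisymm
    · refine TwoSidedIdeal.span_le.2 fun x hx => ?_
      rcases hs.gens x hx with h | h | ⟨p, r, h, -⟩ | h
      · exact TwoSidedIdeal.subset_span (Or.inr h)
      · simp [hs.Wn_empty (Or.inr hc)] at h
      · simp [hc] at h
      · exact TwoSidedIdeal.span_mono Set.subset_union_left h
    · refine TwoSidedIdeal.span_le.2 ?_
      rintro x (hx | hx)
      · exact hs.G_ideal x hx
      · exact TwoSidedIdeal.subset_span (hs.W_subset hx)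
  refine ⟨{g | g ∈ s.G} ∪ s.W, (List.finite_toSet s.G).union (hF.subset hs.W_subset), hhom,
    hideal, ?_, ?_⟩
  · ext g
    constructor
    · intro hg
      obtain ⟨q, hq, hgq⟩ := hs.G_degree g hg
      exact ⟨Or.inl hg, q, by have := hs.bound_le; omega, hgq⟩
    · rintro ⟨hg | hg, q, hq, hgq⟩
      · exact hg
      · exact absurd ⟨g, hg, q, hq, hgq⟩ hfin
  · rintro x hx ⟨q, hq, hxq⟩
    rw [hideal] at hx
    -- A multiple of an element of `W` has degree above `n₀ ≥ q`, so in degree `q` only multiples of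
    -- `𝒢` occur.
    have hle : multiples lt ({g | g ∈ s.G} ∪ s.W) {m | monDeg wt m = q} ≤
        multiples lt {g | g ∈ s.G} {m | monDeg wt m = q} := by
      refine Submodule.span_le.2 ?_
      rintro _ ⟨g, hg | hg, a, b, hab, rfl⟩
      · exact mul_mul_mem_multiples hg hab
      · obtain ⟨d, hd⟩ := hFh g (hs.W_subset hg)
        have hab' : monDeg wt (a * LM lt g * b) = q := hab
        simp only [monDeg_mul, hlt.monDeg_LM hd] at hab'
        exact absurd ⟨g, hg, d, by omega, hd⟩ hfin
    exact (hs.confluent hlt hc).divides_LM hlt hq (fun m hm => hm) hxq.1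
      (hle (hxq.mem_multiples hlt hhom hx))

theorem exists_degrees (hlt : IsMonomialOrder lt) (hs : Invariant wt lt n₀ F k s) :
    ∃ e : List ℕ, List.Forall₂ (HasDegree wt) s.G e ∧ e.Pairwise (· ≤ ·) := by
  refine ⟨s.G.map fun g => monDeg wt (LM lt g), ?_, List.pairwise_map.2 hs.G_sorted⟩
  rw [List.forall₂_map_right_iff, List.forall₂_same]
  intro g hg
  obtain ⟨q, hq⟩ := hs.G_homogeneous g hg
  rwa [hlt.monDeg_LM hq]

theorem of_reachable (hwt : ∀ i, 0 < wt i) (hlt : IsMonomialOrder lt) (hF : F.Finite)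
    (hF₀ : ∃ x ∈ F, ∃ q ≤ n₀, HasDegree wt x q) (h : Reachable wt lt n₀ F s) :
    ∃ k, Invariant wt lt n₀ F k s := by
  induction h with
  | refl => exact ⟨0, invariant_init hF₀⟩
  | tail _ hstep ih =>
    obtain ⟨k, hk⟩ := ih
    obtain ⟨k', hk', -⟩ := hk.step hwt hlt hF hstep
    exact ⟨k', hk'⟩

/-- The bound `k` is existential along a run, so the induction is on the value of the measure,
applied to the tail of the run. -/
theorem not_exists_run (hwt : ∀ i, 0 < wt i) (hlt : IsMonomialOrder lt) (hF : F.Finite)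
    (hs : Invariant wt lt n₀ F k s) :
    ¬ ∃ run : ℕ → State K N, run 0 = s ∧ ∀ i, Step wt lt n₀ (run i) (run (i + 1)) := by
  generalize hx : s.measure hlt n₀ k = x
  induction x using WellFoundedLT.induction generalizing s k with
  | _ x ih =>
  rintro ⟨run, rfl, hrun⟩
  obtain ⟨k', hk', hlt'⟩ := hs.step hwt hlt hF (hrun 0)
  exact ih _ (hx ▸ hlt') hk' rfl ⟨fun i => run (i + 1), rfl, fun i => hrun (i + 1)⟩

end Invariant

end FreeGB

theorem proposition2p5 {K : Type*} [Field K] {N : ℕ}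
    (wt : Fin N → ℕ) (hwt : ∀ i, 0 < wt i)
    (lt : FreeGB.Mon N → FreeGB.Mon N → Prop) (hlt : FreeGB.IsMonomialOrder lt)
    {m : ℕ} (hm : 0 < m) (f : Fin m → FreeGB.FreeAlg K N) (d : Fin m → ℕ)
    (hd : ∀ i, FreeGB.HasDegree wt (f i) (d i)) (hmono : Monotone d)
    (n₀ : ℕ) (hpos : 0 < n₀) (hn₀ : d ⟨0, hm⟩ ≤ n₀) :
    -- no run of the algorithm is infinite
    (¬ ∃ run : ℕ → FreeGB.State K N, run 0 = FreeGB.init (Set.range f) ∧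
      ∀ k, FreeGB.Step wt lt n₀ (run k) (run (k + 1))) ∧
    -- no run gets stuck before the end of the algorithm
    (∀ s, FreeGB.Reachable wt lt n₀ (Set.range f) s → s.ctrl ≠ .halted →
      ∃ s', FreeGB.Step wt lt n₀ s s') ∧
    -- every run that has ended has computed what is claimed
    (∀ s, FreeGB.Reachable wt lt n₀ (Set.range f) s → s.ctrl = .halted →
      FreeGB.IsTruncatedGB wt lt n₀ (FreeGB.ideal (Set.range f)) {g | g ∈ s.G} ∧
      ∃ e : List ℕ, List.Forall₂ (FreeGB.HasDegree wt) s.G e ∧ e.Pairwise (· ≤ ·)) := by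
  have hF : (Set.range f).Finite := Set.finite_range f
  have hF₀ : ∃ x ∈ Set.range f, ∃ q ≤ n₀, FreeGB.HasDegree wt x q :=
    ⟨_, ⟨⟨0, hm⟩, rfl⟩, _, hn₀, hd _⟩
  refine ⟨(FreeGB.invariant_init hF₀).not_exists_run hwt hlt hF, fun s hs hc => ?_,
    fun s hs hc => ?_⟩
  · obtain ⟨k, hk⟩ := FreeGB.Invariant.of_reachable hwt hlt hF hF₀ hs
    exact hk.exists_step hc
  · obtain ⟨k, hk⟩ := FreeGB.Invariant.of_reachable hwt hlt hF hF₀ hs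
    exact ⟨hk.isTruncatedGB hlt hF (Set.forall_mem_range.2 fun i => ⟨_, hd i⟩) hc,
      hk.exists_degrees hlt⟩
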